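/- In the online maximum independent set problem without geometric representation, the vertices of an intersection graph of distinct objects from a known family $\mathcal F$ arrive one by one (two vertices are adjacent if and only if their objects have a common point). On arrival of a vertex the algorithm learns only its adjacencies to the earlier vertices, and it must irrevocably accept or reject it so that the accepted vertices always form an independent set. A randomized algorithm $\mathcal A$ is a random deterministic algorithm of this kind. Its competitive ratio (against oblivious adversaries) is $\sup_{I}\mathrm{OPT}(I)/\mathbb E[\mathcal A(I)]\in[0,\infty]$, where $I$ ranges over all finite input sequences fixed in advance, $\mathrm{OPT}(I)$ is the size of a maximum independent set and $\mathcal A(I)$ is the number of accepted vertices. **Corollary.** Without geometric representation, the competitive ratio of every randomized online algorithm for maximum independent set is at least 1. $6.5$ for intersection graphs of unit balls (radius $1$) in $\mathbb R^3$; 2. $2^{d-1}+\tfrac12$ for intersection graphs of translates of a hypercube in $\mathbb R^d$, for every $d\ge 1$; 3. $3$ for intersection graphs of translates of a (filled) regular $k$-gon in the plane, for every $k\ge 3$ with $k\ne 4$; 4. $2^{d}+\tfrac12$ for intersection graphs of congruent hypercubes (arbitrary rotations allowed) in $\mathbb R^d$, for every $d\ge 2$; 5. $c_d\,\alpha M^d$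 for intersection graphs of $\alpha$-fat objects in $\mathbb R^d$ with widths in $[1,M]$, for every $d\ge1$, $\alpha\in(0,1]$ and $M\ge 1$, where $c_d>0$ depends only on $d$. In particular, no randomized algorithm has competitive ratio $o(\alpha M^d)$ as $M\to\infty$. In 5, an object is a compact set $K\subset\mathbb R^d$ with nonempty interior. For $x\in K$ let $\alpha(x)$ be the ratio of the minimum to the maximum distance from $x$ to the boundary of $K$. A point of $K$ maximizing $\alpha(x)$ is an aspect point, $K$ is $\alpha$-fat if the maximum is at least $\alpha$, and the width of $K$ is the minimum distance from an aspect point to the boundary of $K$ (if there are several aspect points, all the resulting widths are required to lie in $[1,M]$). -/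

import Mathlib

open MeasureTheory
open scoped ENNReal

universe u

/-! ### Geometric intersection graphs -/

/-- `G` is the geometric intersection graph of (pairwise distinct) objects of the family `F`:
vertices are assigned distinct members of `F`, and two different vertices are adjacent
iff their objects have a common point. -/
def IsIntersectionGraph {X V : Type*} (F : Set (Set X)) (G : SimpleGraph V) : Prop :=
  ∃ σ : V → Set X, Function.Injective σ ∧ (∀ v, σ v ∈ F) ∧
    ∀ u v, u ≠ v → (G.Adj u v ↔ (σ u ∩ σ v).Nonempty)

/-! ### Online algorithms for maximum independent set, without representation -/

/-- The part of the input revealed when vertex `i` arrives: the graph induced on the vertices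
`0, …, i` (vertices arrive in the order of `Fin n`). -/
def revealedGraph {n : ℕ} (G : SimpleGraph (Fin n)) (i : Fin n) :
    SimpleGraph (Fin (i.1 + 1)) :=
  G.comap (Fin.castLE i.isLt)

/-- A deterministic online decision rule that sees only the graph.
`D n H` says whether the `(n+1)`-st vertex is accepted when the graph revealed so far
(with that vertex as the last one) is `H`. The earlier decisions are themselves determined by `H`. -/
abbrev OnlineRule : Type := (n : ℕ) → SimpleGraph (Fin (n + 1)) → Prop

open Classical in
/-- The set of vertices that the rule `D` accepts on the input sequence `G`. -/
noncomputable def OnlineRule.accepted (D : OnlineRule) {n : ℕ} (G : SimpleGraph (Fin n)) :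
    Finset (Fin n) :=
  Finset.univ.filter fun i => D i.1 (revealedGraph G i)

/-- A randomized online algorithm for the maximum independent set problem on geometric
intersection graphs of objects of `F`, without access to the objects: a random deterministic rule
which, on every intersection graph of objects of `F`, outputs an independent set. -/
structure RandomizedOnlineAlgorithm {X : Type*} (F : Set (Set X)) where
  /-- the sample space of the internal randomness -/
  Ω : Type u
  [measurableSpace : MeasurableSpace Ω]
  /-- the law of the internal randomness -/
  P : Measure Ω
  [isProbabilityMeasure : IsProbabilityMeasure P]
  /-- the deterministic rule that is executed for a given outcome -/
  rule : Ω → OnlineRule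
  measurableSet_rule : ∀ (n : ℕ) (H : SimpleGraph (Fin (n + 1))),
    MeasurableSet {ω | rule ω n H}
  isIndepSet_accepted : ∀ (ω : Ω) (n : ℕ) (G : SimpleGraph (Fin n)),
    IsIntersectionGraph F G → G.IsIndepSet ((rule ω).accepted G : Set (Fin n))

namespace RandomizedOnlineAlgorithm

variable {X : Type*} {F : Set (Set X)}

attribute [instance] measurableSpace isProbabilityMeasure

/-- The expected size of the output on the (fixed in advance) input sequence `G`. -/
noncomputable def expectedSize (A : RandomizedOnlineAlgorithm.{u} F) {n : ℕ}
    (G : SimpleGraph (Fin n)) : ℝ≥0∞ :=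
  ∫⁻ ω, (((A.rule ω).accepted G).card : ℝ≥0∞) ∂A.P

/-- The competitive ratio against oblivious adversaries: the supremum over all input sequences of
the optimum divided by the expected size of the output (`∞` if the latter is `0` for some nonempty
input). -/
noncomputable def competitiveRatio (A : RandomizedOnlineAlgorithm.{u} F) : ℝ≥0∞ :=
  ⨆ (n : ℕ) (G : SimpleGraph (Fin n)) (_ : IsIntersectionGraph F G),
    (G.indepNum : ℝ≥0∞) / A.expectedSize G

end RandomizedOnlineAlgorithm

/-! ### Families of objects -/

/-- All balls of radius one in `ℝ^d`. -/
def unitBalls (d : ℕ) : Set (Set (EuclideanSpace ℝ (Fin d))) :=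
  {K | ∃ c, K = Metric.closedBall c 1}

/-- All translates of `K`. -/
def translates {d : ℕ} (K : Set (EuclideanSpace ℝ (Fin d))) :
    Set (Set (EuclideanSpace ℝ (Fin d))) :=
  {L | ∃ v, L = (fun x => v + x) '' K}

/-- All sets congruent to `K`. -/
def congruentCopies {d : ℕ} (K : Set (EuclideanSpace ℝ (Fin d))) :
    Set (Set (EuclideanSpace ℝ (Fin d))) :=
  {L | ∃ e : EuclideanSpace ℝ (Fin d) ≃ᵢ EuclideanSpace ℝ (Fin d), L = e '' K}

/-- `K` is a hypercube in `ℝ^d`, of any side length `a > 0`, position and orientation. -/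
def IsHypercube {d : ℕ} (K : Set (EuclideanSpace ℝ (Fin d))) : Prop :=
  ∃ a : ℝ, 0 < a ∧ K ∈ congruentCopies {x | ∀ i, x i ∈ Set.Icc 0 a}

/-- `K` is a (filled) regular `k`-gon in the plane, of any circumradius `r > 0`, position and
orientation. -/
def IsRegularPolygon (k : ℕ) (K : Set (EuclideanSpace ℝ (Fin 2))) : Prop :=
  ∃ r : ℝ, 0 < r ∧ K ∈ congruentCopies (convexHull ℝ (Set.range fun i : Fin k =>
    !₂[r * Real.cos (2 * Real.pi * (i : ℝ) / k), r * Real.sin (2 * Real.pi * (i : ℝ) / k)]))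

/-- The minimum distance from `x` to the boundary of `K`. -/
noncomputable def minBoundaryDist {d : ℕ} (K : Set (EuclideanSpace ℝ (Fin d)))
    (x : EuclideanSpace ℝ (Fin d)) : ℝ :=
  Metric.infDist x (frontier K)

/-- The maximum distance from `x` to the boundary of `K`. -/
noncomputable def maxBoundaryDist {d : ℕ} (K : Set (EuclideanSpace ℝ (Fin d)))
    (x : EuclideanSpace ℝ (Fin d)) : ℝ :=
  sSup ((fun y => dist x y) '' frontier K)

/-- `x` is an aspect point of `K`: it maximizes over `K` the ratio of the minimum to the maximum
distance to the boundary. -/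
def IsAspectPoint {d : ℕ} (K : Set (EuclideanSpace ℝ (Fin d)))
    (x : EuclideanSpace ℝ (Fin d)) : Prop :=
  x ∈ K ∧ ∀ y ∈ K, minBoundaryDist K y / maxBoundaryDist K y ≤
    minBoundaryDist K x / maxBoundaryDist K x

/-- `K` is an `α`-fat object: a compact set with nonempty interior whose aspect ratio (the ratio
of the minimum to the maximum boundary distance at an aspect point) is at least `α`. -/
def IsFatObject {d : ℕ} (α : ℝ) (K : Set (EuclideanSpace ℝ (Fin d))) : Prop :=
  IsCompact K ∧ (interior K).Nonempty ∧
    ∃ x, IsAspectPoint K x ∧ α ≤ minBoundaryDist K x / maxBoundaryDist K x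

/-- The `α`-fat objects in `ℝ^d` with width in `[1, M]`; the width is the minimum distance from
an aspect point to the boundary, and if there are several aspect points, all the resulting widths
are required to lie in `[1, M]`. -/
def fatObjects (d : ℕ) (α M : ℝ) : Set (Set (EuclideanSpace ℝ (Fin d))) :=
  {K | IsFatObject α K ∧ ∀ x, IsAspectPoint K x → minBoundaryDist K x ∈ Set.Icc 1 M}

/-!
The lower bounds come from one adversary, which needs a *touching chain* of length `L`: pairwise
disjoint objects `g 0, …, g (L - 1)` and pairwise intersecting objects `c 0, …, c (L - 1)` such
that `c k` meets exactly the `g i` with `i ≥ k`.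

The adversary presents `L` phases of `m` vertices each. In phase `k`, one slot is chosen uniformly
at random and filled with `g k`; the others are filled with small translates of `c k`. On arrival,
each vertex is adjacent to all earlier vertices of its phase and to all copies of the `c j` of
earlier phases, and to nothing else. So the algorithm cannot tell which vertex of the current phase
is the good one (`revealedGraph_phaseGraph_update`). It accepts at most one vertex per phase, and
this is the good one with probability at most `1 / m` (`card_filter_good_accepted_mul_le`). If it
is not, then everything that follows is blocked (`card_accepted_phaseGraph_le`). Hence the
expected size of the output is at most `1 + L / m`, whereas the good vertices form an independent
set of size `L`. As `m → ∞`, the competitive ratio of every randomized algorithm is seen to be at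
least `L` (`RandomizedOnlineAlgorithm.natCast_le_competitiveRatio`). A touching chain whose
intersections are stable under small translations realizes these graphs in every translation
invariant family (`IsTouchingChain.isIntersectionGraph_phaseGraph`).

It remains to find chains. In the constructions, the `g i` are called leaves and the `c k` hubs; the
hubs are the successive positions of one moving object.
* For unit balls in `ℝ^3`, an explicit chain of length `7`.
* For translates of the cube `[0, 1]^d`, a chain of length `2 ^ d`: there is one leaf in each
  orthant, and the hub moves monotonically in all coordinates, leaving the leaves one by one in the
  order of the binary numbers given by the signs of their coordinates.
* For regular `k`-gons, an explicit chain of length `3`. For `k ≥ 4` it can be verified by means of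
  the inscribed and the circumscribed circle, for `k = 3` the triangle is mapped affinely to a right
  triangle.
* For congruent cubes, a chain of length `5 * 2 ^ (d - 2)`, which exceeds `2 ^ d`: in the plane,
  a square rotated by `45°` can leave five axis-parallel squares one after the other. This is
  combined with the construction for cubes in the other `d - 2` coordinates.
* For fat objects, balls are sufficient: a ball of radius `M` moves past about `M ^ d` disjoint unit
  balls and leaves them one after the other, while any two of its positions intersect.
-/

/-! ### The phase graphs -/

/-- The input graph with `L` phases of `m` vertices each, in which `s k` is the good slot of
phase `k`. The vertices of one phase form a clique. A vertex in a slot other than the good one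
is adjacent to all vertices of later phases, a vertex in the good slot to none of them.
The vertex in slot `j` of phase `k` is encoded as the number `k * m + j`. -/
def phaseGraph {L m : ℕ} (s : Fin L → Fin m) : SimpleGraph (Fin (L * m)) where
  Adj u v := u ≠ v ∧ (u.divNat = v.divNat ∨
    (u.divNat < v.divNat ∧ u.modNat ≠ s u.divNat) ∨
    (v.divNat < u.divNat ∧ v.modNat ≠ s v.divNat))
  symm := ⟨fun u v h => ⟨h.1.symm, by
    rcases h.2 with h | h | h
    · exact Or.inl h.symm
    · exact Or.inr (Or.inr h)
    · exact Or.inr (Or.inl h)⟩⟩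
  loopless := ⟨fun _ h => h.1 rfl⟩

/-- The vertex in slot `j` of phase `k`. -/
def phaseVertex {L m : ℕ} (k : Fin L) (j : Fin m) : Fin (L * m) := finProdFinEquiv (k, j)

@[simp] lemma divNat_phaseVertex {L m : ℕ} (k : Fin L) (j : Fin m) :
    (phaseVertex k j).divNat = k :=
  congrArg Prod.fst (finProdFinEquiv.symm_apply_apply (k, j))

@[simp] lemma modNat_phaseVertex {L m : ℕ} (k : Fin L) (j : Fin m) :
    (phaseVertex k j).modNat = j :=
  congrArg Prod.snd (finProdFinEquiv.symm_apply_apply (k, j))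

lemma phaseVertex_divNat_modNat {L m : ℕ} (i : Fin (L * m)) :
    phaseVertex i.divNat i.modNat = i :=
  finProdFinEquiv.apply_symm_apply i

lemma phaseVertex_injective {L m : ℕ} {k k' : Fin L} {j j' : Fin m}
    (h : phaseVertex k j = phaseVertex k' j') : k = k' ∧ j = j' := by
  have := finProdFinEquiv.injective h
  exact Prod.ext_iff.1 this

lemma divNat_mono {L m : ℕ} {u v : Fin (L * m)} (h : u ≤ v) : u.divNat ≤ v.divNat := by
  rw [Fin.le_def, Fin.coe_divNat, Fin.coe_divNat]
  exact Nat.div_le_div_right h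

/-- The part of the phase graph that is revealed on arrival of a vertex of phase `k` does not
depend on the good slot of phase `k`: the vertices of a phase are indistinguishable until the
phase is over. -/
lemma revealedGraph_phaseGraph_update {L m : ℕ} (s : Fin L → Fin m) (i : Fin (L * m))
    (j : Fin m) :
    revealedGraph (phaseGraph (Function.update s i.divNat j)) i
      = revealedGraph (phaseGraph s) i := by
  ext u v
  have key : ∀ w : Fin (i.1 + 1), (Fin.castLE i.isLt w).divNat ≤ i.divNat := fun w =>
    divNat_mono (by rw [Fin.le_def]; simpa using Nat.lt_succ_iff.1 w.isLt)
  have hne : ∀ a b : Fin L, a < b → b ≤ i.divNat →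
      Function.update s i.divNat j a = s a := fun a b hab hb =>
    Function.update_of_ne (ne_of_lt (lt_of_lt_of_le hab hb)) _ _
  simp only [revealedGraph, SimpleGraph.comap_adj, phaseGraph]
  have h1 := fun h => hne (Fin.castLE i.isLt u).divNat _ h (key v)
  have h2 := fun h => hne (Fin.castLE i.isLt v).divNat _ h (key u)
  constructor
  · rintro ⟨h, h' | ⟨h', h''⟩ | ⟨h', h''⟩⟩
    · exact ⟨h, Or.inl h'⟩
    · exact ⟨h, Or.inr (Or.inl ⟨h', by rwa [h1 h'] at h''⟩)⟩
    · exact ⟨h, Or.inr (Or.inr ⟨h', by rwa [h2 h'] at h''⟩)⟩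
  · rintro ⟨h, h' | ⟨h', h''⟩ | ⟨h', h''⟩⟩
    · exact ⟨h, Or.inl h'⟩
    · exact ⟨h, Or.inr (Or.inl ⟨h', by rwa [h1 h']⟩)⟩
    · exact ⟨h, Or.inr (Or.inr ⟨h', by rwa [h2 h']⟩)⟩

/-- The good vertices are independent. -/
lemma le_indepNum_phaseGraph {L m : ℕ} (s : Fin L → Fin m) :
    L ≤ (phaseGraph s).indepNum := by
  classical
  have hinj : Function.Injective fun k => phaseVertex k (s k) := fun k k' h =>
    (phaseVertex_injective h).1
  have : (phaseGraph s).IsIndepSet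
      ((Finset.univ.image fun k => phaseVertex k (s k) : Finset (Fin (L * m))) :
        Set (Fin (L * m))) := by
    rw [SimpleGraph.isIndepSet_iff]
    intro u hu v hv huv
    simp only [Finset.coe_image, Finset.coe_univ, Set.image_univ, Set.mem_range] at hu hv
    obtain ⟨k, rfl⟩ := hu
    obtain ⟨k', rfl⟩ := hv
    rintro ⟨-, h | ⟨-, h⟩ | ⟨-, h⟩⟩
    · simp only [divNat_phaseVertex] at h
      exact huv (by rw [h])
    · simp at h
    · simp at h
  simpa [Finset.card_image_of_injective _ hinj] using this.card_le_indepNum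

/-! ### The behaviour of a deterministic rule on the phase graphs -/

lemma mem_accepted {D : OnlineRule} {n : ℕ} {G : SimpleGraph (Fin n)} {i : Fin n} :
    i ∈ D.accepted G ↔ D i.1 (revealedGraph G i) := by
  simp [OnlineRule.accepted]

lemma mem_accepted_phaseGraph_update {D : OnlineRule} {L m : ℕ} (s : Fin L → Fin m)
    (k : Fin L) (j j' : Fin m) :
    phaseVertex k j' ∈ D.accepted (phaseGraph (Function.update s k j)) ↔
      phaseVertex k j' ∈ D.accepted (phaseGraph s) := by
  rw [mem_accepted, mem_accepted]
  have := revealedGraph_phaseGraph_update s (phaseVertex k j') j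
  rw [divNat_phaseVertex] at this
  rw [this]

/-- Accepting a vertex that is not good precludes accepting anything in later phases. So all
accepted vertices but at most one are good. -/
lemma card_accepted_phaseGraph_le {D : OnlineRule} {L m : ℕ} (s : Fin L → Fin m)
    (hD : (phaseGraph s).IsIndepSet (D.accepted (phaseGraph s) : Set (Fin (L * m)))) :
    (D.accepted (phaseGraph s)).card ≤
      1 + (Finset.univ.filter fun k => phaseVertex k (s k) ∈ D.accepted (phaseGraph s)).card := by
  classical
  rw [SimpleGraph.isIndepSet_iff] at hD
  set A := D.accepted (phaseGraph s) with hA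
  rw [← Finset.card_filter_add_card_filter_not (s := A) (fun i => i.modNat ≠ s i.divNat)]
  refine add_le_add ?_ ?_
  · rw [Finset.card_le_one]
    intro u hu v hv
    rw [Finset.mem_filter] at hu hv
    by_contra huv
    refine hD hu.1 hv.1 huv ⟨huv, ?_⟩
    rcases lt_trichotomy u.divNat v.divNat with h | h | h
    · exact Or.inr (Or.inl ⟨h, hu.2⟩)
    · exact Or.inl h
    · exact Or.inr (Or.inr ⟨h, hv.2⟩)
  · refine Finset.card_le_card_of_injOn (fun i => i.divNat) ?_ ?_
    · intro i hi
      simp only [ne_eq, not_not, Finset.coe_filter, Set.mem_ofPred_eq] at hi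
      simp only [Finset.coe_filter, Finset.mem_univ, true_and, Set.mem_ofPred_eq]
      rw [← hi.2, phaseVertex_divNat_modNat]
      exact hi.1
    · intro u hu v hv h
      simp only [ne_eq, not_not, Finset.coe_filter, Set.mem_ofPred_eq] at hu hv h
      rw [← phaseVertex_divNat_modNat u, ← phaseVertex_divNat_modNat v, hu.2, hv.2, h]

/-- For each phase, at most every `m`-th choice of the good slots lets the rule accept the good
vertex of that phase. -/
lemma card_filter_good_accepted_mul_le {D : OnlineRule} {L m : ℕ}
    (hD : ∀ s : Fin L → Fin m,
      (phaseGraph s).IsIndepSet (D.accepted (phaseGraph s) : Set (Fin (L * m)))) (k : Fin L) :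
    (Finset.univ.filter fun s : Fin L → Fin m =>
      phaseVertex k (s k) ∈ D.accepted (phaseGraph s)).card * m ≤ m ^ L := by
  classical
  set B := Finset.univ.filter fun s : Fin L → Fin m =>
      phaseVertex k (s k) ∈ D.accepted (phaseGraph s) with hB
  have : (B ×ˢ (Finset.univ : Finset (Fin m))).card ≤
      (Finset.univ : Finset (Fin L → Fin m)).card := by
    refine Finset.card_le_card_of_injOn (fun p => Function.update p.1 k p.2)
      (fun _ _ => Finset.mem_coe.2 (Finset.mem_univ _)) ?_
    rintro ⟨s, j⟩ hs ⟨s', j'⟩ hs' h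
    simp only [hB, Finset.coe_product, Set.mem_prod, Finset.coe_filter, Finset.mem_univ, true_and,
      Set.mem_ofPred_eq, Finset.coe_univ, Set.mem_univ, and_true] at hs hs' h
    have hj : j = j' := by simpa using congrFun h k
    have hne : ∀ i, i ≠ k → s i = s' i := fun i hi => by
      simpa [Function.update_of_ne hi] using congrFun h i
    have hk : s k = s' k := by
      by_contra hk
      have e : s = Function.update s' k (s k) := by
        funext i
        by_cases hi : i = k
        · subst hi; simp
        · rw [Function.update_of_ne hi, hne i hi]
      -- both good vertices of phase `k` are accepted on the input given by `s'`
      rw [e, mem_accepted_phaseGraph_update, Function.update_self] at hs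
      have hv : phaseVertex k (s k) ≠ phaseVertex k (s' k) := fun h =>
        hk (phaseVertex_injective h).2
      exact SimpleGraph.isIndepSet_iff _ |>.1 (hD s') hs hs' hv ⟨hv, Or.inl (by simp)⟩
    refine Prod.ext (funext fun i => ?_) hj
    by_cases hi : i = k
    · subst hi; exact hk
    · exact hne i hi
  simpa [Finset.card_product] using this

/-- The average size of the output over all phase graphs is at most `1 + L / m`. -/
lemma sum_card_accepted_phaseGraph_le {D : OnlineRule} {L m : ℕ}
    (hD : ∀ s : Fin L → Fin m,
      (phaseGraph s).IsIndepSet (D.accepted (phaseGraph s) : Set (Fin (L * m)))) :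
    (∑ s : Fin L → Fin m, (D.accepted (phaseGraph s)).card) * m ≤ m ^ L * (m + L) := by
  classical
  calc (∑ s : Fin L → Fin m, (D.accepted (phaseGraph s)).card) * m
      ≤ (∑ s : Fin L → Fin m, (1 + (Finset.univ.filter fun k =>
          phaseVertex k (s k) ∈ D.accepted (phaseGraph s)).card)) * m :=
        Nat.mul_le_mul_right _ (Finset.sum_le_sum fun s _ => card_accepted_phaseGraph_le s (hD s))
    _ = m ^ L * m + (∑ k : Fin L, (Finset.univ.filter fun s : Fin L → Fin m =>
          phaseVertex k (s k) ∈ D.accepted (phaseGraph s)).card * m) := by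
        rw [Finset.sum_add_distrib, add_mul]
        congr 1
        · simp
        · rw [← Finset.sum_mul]
          simp only [Finset.card_filter]
          rw [Finset.sum_comm]
    _ ≤ m ^ L * m + ∑ _k : Fin L, m ^ L :=
        Nat.add_le_add_left
          (Finset.sum_le_sum fun k _ => card_filter_good_accepted_mul_le hD k) _
    _ = m ^ L * (m + L) := by
        simp only [Finset.sum_const, Finset.card_univ, Fintype.card_fin, smul_eq_mul]; ring

/-! ### From phase graphs to the competitive ratio -/

namespace RandomizedOnlineAlgorithm

variable {X : Type*} {F : Set (Set X)}

lemma measurable_card_accepted (A : RandomizedOnlineAlgorithm.{u} F) {n : ℕ}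
    (G : SimpleGraph (Fin n)) :
    Measurable fun ω => (((A.rule ω).accepted G).card : ℝ≥0∞) := by
  classical
  have : (fun ω => (((A.rule ω).accepted G).card : ℝ≥0∞)) =
      fun ω => ∑ i : Fin n, Set.indicator {ω | A.rule ω i.1 (revealedGraph G i)} 1 ω := by
    funext ω
    simp only [OnlineRule.accepted, Finset.card_filter, Nat.cast_sum, Nat.cast_ite, Nat.cast_one,
      Nat.cast_zero]
    exact Finset.sum_congr rfl fun i _ => by simp [Set.indicator_apply]
  rw [this]
  exact Finset.measurable_sum _ fun i _ =>
    measurable_one.indicator (A.measurableSet_rule i.1 (revealedGraph G i))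

/-- If all phase graphs with `L` phases occur as intersection graphs, then no randomized
algorithm is better than `L`-competitive. -/
theorem natCast_le_competitiveRatio (A : RandomizedOnlineAlgorithm.{u} F) {L : ℕ}
    (hF : ∀ (m : ℕ) (s : Fin L → Fin m), IsIntersectionGraph F (phaseGraph s)) :
    (L : ℝ≥0∞) ≤ A.competitiveRatio := by
  by_cases htop : A.competitiveRatio = ∞
  · simp [htop]
  have key : ∀ m : ℕ, 0 < m → (L : ℝ≥0∞) * m ≤ A.competitiveRatio * (m + L) := by
    intro m hm
    have hle : ∀ s : Fin L → Fin m,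
        (L : ℝ≥0∞) ≤ A.competitiveRatio * A.expectedSize (phaseGraph s) := by
      intro s
      have h1 : ((phaseGraph s).indepNum : ℝ≥0∞) / A.expectedSize (phaseGraph s) ≤
          A.competitiveRatio :=
        le_iSup_of_le (L * m) (le_iSup_of_le (phaseGraph s) (le_iSup_of_le (hF m s) le_rfl))
      have h2 : (L : ℝ≥0∞) ≤ ((phaseGraph s).indepNum : ℝ≥0∞) := by
        exact_mod_cast le_indepNum_phaseGraph s
      have h3 : A.expectedSize (phaseGraph s) ≠ ∞ := by
        refine ne_top_of_le_ne_top (ENNReal.natCast_ne_top (L * m)) ?_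
        calc A.expectedSize (phaseGraph s) ≤ ∫⁻ _, ((L * m : ℕ) : ℝ≥0∞) ∂A.P :=
              lintegral_mono fun ω => by
                have := Finset.card_le_univ ((A.rule ω).accepted (phaseGraph s))
                rw [Fintype.card_fin] at this
                exact Nat.cast_le.2 this
          _ = _ := by simp
      by_cases h0 : A.expectedSize (phaseGraph s) = 0
      · by_cases hL : (L : ℝ≥0∞) = 0
        · simp [hL]
        · rw [h0, ENNReal.div_zero (fun h => hL (le_antisymm (h ▸ h2) zero_le))] at h1
          exact absurd (top_le_iff.1 h1) htop
      · exact h2.trans ((ENNReal.div_le_iff h0 h3).1 h1)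
    have hsum : (∑ s : Fin L → Fin m, A.expectedSize (phaseGraph s)) * m ≤
        (m : ℝ≥0∞) ^ L * (m + L) := by
      simp only [expectedSize]
      rw [← lintegral_finsetSum _ fun s _ => A.measurable_card_accepted _,
        ← lintegral_mul_const _ (Finset.measurable_sum _ fun s _ =>
          A.measurable_card_accepted _)]
      calc _ ≤ ∫⁻ _, (m : ℝ≥0∞) ^ L * (m + L) ∂A.P := lintegral_mono fun ω => by
              have := sum_card_accepted_phaseGraph_le (D := A.rule ω) (L := L) (m := m)
                fun s => A.isIndepSet_accepted ω _ _ (hF m s)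
              have h : (((∑ s : Fin L → Fin m, ((A.rule ω).accepted (phaseGraph s)).card) * m : ℕ)
                : ℝ≥0∞) ≤ ((m ^ L * (m + L) : ℕ) : ℝ≥0∞) := by exact_mod_cast this
              simpa using h
        _ = _ := by simp
    have hpow0 : (m : ℝ≥0∞) ^ L ≠ 0 := by
      have : (m : ℝ≥0∞) ≠ 0 := by exact_mod_cast hm.ne'
      exact pow_ne_zero _ this
    have hpowt : (m : ℝ≥0∞) ^ L ≠ ∞ := ENNReal.pow_ne_top (ENNReal.natCast_ne_top _)
    rw [← ENNReal.mul_le_mul_iff_right hpow0 hpowt]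
    calc (m : ℝ≥0∞) ^ L * (L * m) = (∑ _s : Fin L → Fin m, (L : ℝ≥0∞)) * m := by
          simp [Finset.sum_const, nsmul_eq_mul, mul_assoc]
      _ ≤ (∑ s : Fin L → Fin m, A.competitiveRatio * A.expectedSize (phaseGraph s)) * m := by
          gcongr with s; exact hle s
      _ = A.competitiveRatio * ((∑ s : Fin L → Fin m, A.expectedSize (phaseGraph s)) * m) := by
          rw [← Finset.mul_sum, mul_assoc]
      _ ≤ A.competitiveRatio * ((m : ℝ≥0∞) ^ L * (m + L)) := by gcongr
      _ = (m : ℝ≥0∞) ^ L * (A.competitiveRatio * (m + L)) := by ring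
  -- let `m` tend to infinity
  lift A.competitiveRatio to NNReal using htop with R
  have key' : ∀ m : ℕ, 0 < m → (L : ℝ) * m ≤ R * (m + L) := by
    intro m hm
    have := key m hm
    exact_mod_cast this
  suffices (L : ℝ) ≤ R by exact_mod_cast this
  by_contra! hlt
  obtain ⟨m, hm⟩ := exists_nat_gt ((R : ℝ) * L / (L - R))
  have hm0 : 0 < m := by
    have : (0 : ℝ) ≤ (R : ℝ) * L / (L - R) :=
      div_nonneg (mul_nonneg R.2 (Nat.cast_nonneg _)) (by linarith)
    exact_mod_cast this.trans_lt hm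
  rw [div_lt_iff₀ (by linarith)] at hm
  have := key' m hm0
  nlinarith

end RandomizedOnlineAlgorithm

/-- An injection that maps the members of `F` to members of `F'` turns intersection graphs of
`F` into intersection graphs of `F'`. -/
lemma IsIntersectionGraph.image {X Y V : Type*} {F : Set (Set X)} {F' : Set (Set Y)}
    {G : SimpleGraph V} (h : IsIntersectionGraph F G) {f : X → Y} (hf : Function.Injective f)
    (hF : ∀ S ∈ F, f '' S ∈ F') : IsIntersectionGraph F' G := by
  obtain ⟨σ, hσ, hm, ha⟩ := h
  refine ⟨fun v => f '' σ v, hf.image_injective.comp hσ, fun v => hF _ (hm v), fun u v huv => ?_⟩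
  rw [ha u v huv, ← Set.image_inter hf, Set.image_nonempty]

lemma IsIntersectionGraph.mono {X V : Type*} {F F' : Set (Set X)}
    {G : SimpleGraph V} (h : IsIntersectionGraph F G) (hF : F ⊆ F') :
    IsIntersectionGraph F' G := by
  obtain ⟨σ, hσ, hm, ha⟩ := h
  exact ⟨σ, hσ, fun v => hF (hm v), ha⟩

/-! ### Chains of objects -/

/-- A chain of length `L` in `F`: pairwise disjoint members `g i` of `F` and pairwise
intersecting members `c k` such that `c k` meets `g i` if and only if `k ≤ i`. The intersections
are required to be stable under small translations of the `c k`. -/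
structure IsTouchingChain {E : Type*} [TopologicalSpace E] (F : Set (Set E)) {L : ℕ}
    (c g : Fin L → Set E) : Prop where
  mem_c : ∀ k, c k ∈ F
  mem_g : ∀ i, g i ∈ F
  isCompact_c : ∀ k, IsCompact (c k)
  isCompact_g : ∀ i, IsCompact (g i)
  disjoint_g : ∀ i j, i ≠ j → Disjoint (g i) (g j)
  disjoint_c_g : ∀ i k, i < k → Disjoint (c k) (g i)
  inter_c_g : ∀ k i, k ≤ i → (interior (c k) ∩ g i).Nonempty
  inter_c_c : ∀ k k', k ≤ k' → (interior (c k) ∩ c k').Nonempty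

section Perturbation

variable {E : Type*} [NormedAddCommGroup E]

/-- The translate of `S` by the vector `v`. -/
def translateSet (v : E) (S : Set E) : Set E := (fun x => v + x) '' S

lemma mem_translateSet {v : E} {S : Set E} {x : E} : x ∈ translateSet v S ↔ x - v ∈ S := by
  constructor
  · rintro ⟨y, hy, rfl⟩
    simpa using hy
  · intro h
    exact ⟨x - v, h, by simp⟩

lemma translateSet_translateSet (v w : E) (S : Set E) :
    translateSet v (translateSet w S) = translateSet (v + w) S := by
  ext x
  simp only [mem_translateSet]
  rw [sub_sub]

variable [NormedSpace ℝ E]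

/-- A bounded nonempty set is not a translate of itself by a nonzero vector. -/
lemma eq_of_translateSet_eq {S : Set E} (hS : Bornology.IsBounded S) (hne : S.Nonempty) {v w : E}
    (h : translateSet v S = translateSet w S) : v = w := by
  by_contra hvw
  obtain ⟨x, hx⟩ := hne
  have step : ∀ y ∈ S, y + (v - w) ∈ S := by
    intro y hy
    have : v + y ∈ translateSet w S := h ▸ ⟨y, hy, rfl⟩
    rw [mem_translateSet] at this
    convert this using 1
    abel
  have hn : ∀ n : ℕ, x + n • (v - w) ∈ S := by
    intro n
    induction n with
    | zero => simpa using hx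
    | succ n ih =>
      have := step _ ih
      rwa [add_assoc, ← succ_nsmul] at this
  obtain ⟨C, hC⟩ := hS.exists_norm_le
  have hpos : 0 < ‖v - w‖ := norm_pos_iff.2 (sub_ne_zero.2 hvw)
  obtain ⟨n, hn'⟩ := exists_nat_gt ((C + ‖x‖) / ‖v - w‖)
  rw [div_lt_iff₀ hpos] at hn'
  have h1 := hC _ (hn n)
  have h2 : ‖n • (v - w)‖ ≤ ‖x + n • (v - w)‖ + ‖x‖ := by
    have := norm_sub_le (x + n • (v - w)) x
    simpa using this
  rw [← Nat.cast_smul_eq_nsmul ℝ, norm_smul, Real.norm_natCast] at h2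
  rw [← Nat.cast_smul_eq_nsmul ℝ] at h1
  linarith

open Filter Topology in
lemma eventually_translateSet_inter_nonempty {S T : Set E} (h : (interior S ∩ T).Nonempty) (w : E) :
    ∀ᶠ t : ℝ in 𝓝 0, (translateSet (t • w) S ∩ T).Nonempty := by
  obtain ⟨x, hxS, hxT⟩ := h
  have hc : Tendsto (fun t : ℝ => x - t • w) (𝓝 0) (𝓝 x) := by
    have : Continuous fun t : ℝ => x - t • w := by fun_prop
    simpa using this.tendsto 0
  filter_upwards [hc (isOpen_interior.mem_nhds hxS)] with t ht
  exact ⟨x, mem_translateSet.2 (interior_subset ht), hxT⟩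

open Filter Topology in
lemma eventually_disjoint_translateSet {S T : Set E} (hS : IsCompact S) (hT : IsCompact T)
    (h : Disjoint S T) (w : E) :
    ∀ᶠ t : ℝ in 𝓝 0, Disjoint (translateSet (t • w) S) T := by
  obtain ⟨U, V, hU, hV, hSU, hTV, hUV⟩ := SeparatedNhds.of_isCompact_isCompact hS hT h
  have hc : Continuous fun p : ℝ × E => p.1 • w + p.2 := by fun_prop
  have : ∀ᶠ t : ℝ in 𝓝 0, ∀ x ∈ S, t • w + x ∈ U := by
    refine hS.eventually_forall_of_forall_eventually fun x hx => ?_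
    exact (hU.preimage hc).mem_nhds (by simpa using hSU hx)
  filter_upwards [this] with t ht
  refine hUV.mono ?_ hTV
  rintro _ ⟨x, hx, rfl⟩
  exact ht x hx

open Filter Topology in
/-- A touching chain of length `L` in a translation invariant family realizes all phase graphs
with `L` phases: the good vertex of phase `k` is `g k`, the other vertices of phase `k` are small
translates of `c k`. -/
theorem IsTouchingChain.isIntersectionGraph_phaseGraph [Nontrivial E] {F : Set (Set E)}
    (hF : ∀ S ∈ F, ∀ v, translateSet v S ∈ F) {L : ℕ} {c g : Fin L → Set E}
    (h : IsTouchingChain F c g) (m : ℕ) (s : Fin L → Fin m) :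
    IsIntersectionGraph F (phaseGraph s) := by
  obtain ⟨w, hw⟩ := exists_ne (0 : E)
  have hcne : ∀ k, (c k).Nonempty := fun k => (h.inter_c_c k k le_rfl).mono Set.inter_subset_right
  have hgne : ∀ i, (g i).Nonempty := fun i => (h.inter_c_g i i le_rfl).mono Set.inter_subset_right
  have htr : ∀ k (t t' : ℝ), translateSet (t • w) (c k) = translateSet (t' • w) (c k) → t = t' :=
    fun k t t' he => smul_left_injective ℝ hw
      (eq_of_translateSet_eq (h.isCompact_c k).isBounded (hcne k) he)
  have h1 : ∀ᶠ t : ℝ in 𝓝[≠] 0, ∀ k i, k ≤ i → (translateSet (t • w) (c k) ∩ g i).Nonempty := by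
    refine eventually_nhdsWithin_of_eventually_nhds ?_
    simp only [eventually_all]
    exact fun k i hki => eventually_translateSet_inter_nonempty (h.inter_c_g k i hki) w
  have h2 : ∀ᶠ t : ℝ in 𝓝[≠] 0, ∀ k i, i < k → Disjoint (translateSet (t • w) (c k)) (g i) := by
    refine eventually_nhdsWithin_of_eventually_nhds ?_
    simp only [eventually_all]
    exact fun k i hki => eventually_disjoint_translateSet (h.isCompact_c k) (h.isCompact_g i)
      (h.disjoint_c_g i k hki) w
  have h3 : ∀ᶠ t : ℝ in 𝓝 0, ∀ k k', k ≤ k' → (translateSet (t • w) (c k) ∩ c k').Nonempty := by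
    simp only [eventually_all]
    exact fun k i hki => eventually_translateSet_inter_nonempty (h.inter_c_c k i hki) w
  -- for each `k` and `i`, at most one translation carries `c k` onto `g i`
  have h4 : ∀ᶠ t : ℝ in 𝓝[≠] 0, ∀ k i, translateSet (t • w) (c k) ≠ g i := by
    simp only [eventually_all]
    intro k i
    by_cases hex : ∃ t₀ : ℝ, translateSet (t₀ • w) (c k) = g i
    · obtain ⟨t₀, ht₀⟩ := hex
      by_cases h0 : t₀ = 0
      · filter_upwards [self_mem_nhdsWithin] with t ht he
        exact ht ((htr k t t₀ (he.trans ht₀.symm)).trans h0)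
      · refine eventually_nhdsWithin_of_eventually_nhds ?_
        filter_upwards [isOpen_ne.mem_nhds (Ne.symm h0)] with t ht he
        exact ht (htr k t t₀ (he.trans ht₀.symm))
    · exact Eventually.of_forall fun t he => hex ⟨t, he⟩
  obtain ⟨ε, hε, h3'⟩ := Metric.eventually_nhds_iff.1 h3
  have hball : ∀ᶠ t : ℝ in 𝓝[≠] 0, |t| < ε / 2 := by
    refine eventually_nhdsWithin_of_eventually_nhds ?_
    filter_upwards [Metric.ball_mem_nhds (0 : ℝ) (half_pos hε)] with t ht
    simpa using ht
  have hinf : Set.Infinite {t : ℝ | ((∀ k i, k ≤ i → (translateSet (t • w) (c k) ∩ g i).Nonempty) ∧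
      (∀ k i, i < k → Disjoint (translateSet (t • w) (c k)) (g i))) ∧
      (∀ k i, translateSet (t • w) (c k) ≠ g i) ∧ |t| < ε / 2} :=
    fun hfin => infinite_of_mem_nhds (0 : ℝ)
      (insert_mem_nhds_iff.2 ((h1.and h2).and (h4.and hball))) (hfin.insert 0)
  let e := hinf.natEmbedding
  let τ : Fin m → ℝ := fun j => (e j.1).1
  have hτinj : ∀ j j', τ j = τ j' → j = j' := fun j j' hj =>
    Fin.ext (e.injective (Subtype.ext hj))
  have hτ := fun j : Fin m => (e j.1).2
  have c1 : ∀ k j i, k ≤ i → (translateSet (τ j • w) (c k) ∩ g i).Nonempty :=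
    fun k j => (hτ j).1.1 k
  have c2 : ∀ k j i, i < k → Disjoint (translateSet (τ j • w) (c k)) (g i) :=
    fun k j => (hτ j).1.2 k
  have c4 : ∀ k j i, translateSet (τ j • w) (c k) ≠ g i := fun k j => (hτ j).2.1 k
  have c3 : ∀ k j k' j', k ≤ k' →
      (translateSet (τ j • w) (c k) ∩ translateSet (τ j' • w) (c k')).Nonempty := by
    intro k j k' j' hk
    have hb := (hτ j).2.2
    have hb' := (hτ j').2.2
    have hd : dist (τ j - τ j') 0 < ε := by
      rw [Real.dist_eq, sub_zero]
      have := abs_sub (τ j) (τ j')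
      have h' : |τ j| < ε / 2 := hb
      have h'' : |τ j'| < ε / 2 := hb'
      linarith
    obtain ⟨x, hx, hx'⟩ := h3' hd k k' hk
    refine ⟨x + τ j' • w, ?_, ?_⟩
    · rw [mem_translateSet] at hx ⊢
      convert hx using 1
      rw [sub_smul]; abel
    · rw [mem_translateSet]; simpa using hx'
  let σ : Fin (L * m) → Set E := fun v =>
    if v.modNat = s v.divNat then g v.divNat else translateSet (τ v.modNat • w) (c v.divNat)
  have hσg : ∀ v : Fin (L * m), v.modNat = s v.divNat → σ v = g v.divNat := fun v hv => if_pos hv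
  have hσc : ∀ v : Fin (L * m), v.modNat ≠ s v.divNat →
      σ v = translateSet (τ v.modNat • w) (c v.divNat) := fun v hv => if_neg hv
  have hlt : ∀ u v : Fin (L * m), u.divNat < v.divNat →
      ((σ u ∩ σ v).Nonempty ↔ u.modNat ≠ s u.divNat) := by
    intro u v huv
    by_cases hu : u.modNat = s u.divNat
    · refine iff_of_false (fun hne => ?_) (fun h => h hu)
      rw [hσg u hu] at hne
      refine Set.not_disjoint_iff_nonempty_inter.2 hne ?_
      by_cases hv : v.modNat = s v.divNat
      · rw [hσg v hv]
        exact h.disjoint_g _ _ huv.ne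
      · rw [hσc v hv]
        exact (c2 _ _ _ huv).symm
    · refine iff_of_true ?_ hu
      rw [hσc u hu]
      by_cases hv : v.modNat = s v.divNat
      · rw [hσg v hv]
        exact c1 _ _ _ huv.le
      · rw [hσc v hv]
        exact c3 _ _ _ _ huv.le
  have hadj : ∀ u v, u ≠ v → ((phaseGraph s).Adj u v ↔ (σ u ∩ σ v).Nonempty) := by
    intro u v huv
    rcases lt_trichotomy u.divNat v.divNat with hlt' | heq | hlt'
    · rw [hlt u v hlt']
      simp [phaseGraph, huv, hlt', hlt'.ne, hlt'.not_gt]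
    · refine iff_of_true ⟨huv, Or.inl heq⟩ ?_
      by_cases hu : u.modNat = s u.divNat <;> by_cases hv : v.modNat = s v.divNat
      · exact absurd (by rw [← phaseVertex_divNat_modNat u, ← phaseVertex_divNat_modNat v, hu, hv,
          heq]) huv
      · rw [hσg u hu, hσc v hv, Set.inter_comm]
        exact c1 _ _ _ heq.ge
      · rw [hσc u hu, hσg v hv]
        exact c1 _ _ _ heq.le
      · rw [hσc u hu, hσc v hv]
        exact c3 _ _ _ _ heq.le
    · rw [Set.inter_comm, hlt v u hlt']
      simp [phaseGraph, huv, hlt', hlt'.ne', hlt'.not_gt]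
  refine ⟨σ, ?_, ?_, hadj⟩
  · -- objects of different phases are told apart by the `g i` that they meet
    intro u v huv
    by_contra hne
    by_cases hu : u.modNat = s u.divNat <;> by_cases hv : v.modNat = s v.divNat
    · rw [hσg u hu, hσg v hv] at huv
      have hd : u.divNat ≠ v.divNat := fun hd => hne (by
        rw [← phaseVertex_divNat_modNat u, ← phaseVertex_divNat_modNat v, hu, hv, hd])
      have := h.disjoint_g _ _ hd
      rw [huv, disjoint_self] at this
      exact (hgne _).ne_empty this
    · rw [hσg u hu, hσc v hv] at huv
      exact c4 _ _ _ huv.symm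
    · rw [hσc u hu, hσg v hv] at huv
      exact c4 _ _ _ huv
    · rw [hσc u hu, hσc v hv] at huv
      rcases lt_trichotomy u.divNat v.divNat with hd | hd | hd
      · exact Set.not_disjoint_iff_nonempty_inter.2 (c1 u.divNat u.modNat u.divNat le_rfl)
          (huv ▸ c2 _ _ _ hd)
      · rw [hd] at huv
        have := hτinj _ _ (htr _ _ _ huv)
        exact hne (by rw [← phaseVertex_divNat_modNat u, ← phaseVertex_divNat_modNat v, this, hd])
      · exact Set.not_disjoint_iff_nonempty_inter.2 (c1 v.divNat v.modNat v.divNat le_rfl)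
          (huv ▸ c2 _ _ _ hd)
  · intro v
    by_cases hv : v.modNat = s v.divNat
    · rw [hσg v hv]; exact h.mem_g _
    · rw [hσc v hv]; exact hF _ (h.mem_c _) _

theorem IsTouchingChain.natCast_le_competitiveRatio [Nontrivial E] {F : Set (Set E)}
    (hF : ∀ S ∈ F, ∀ v, translateSet v S ∈ F) {L : ℕ} {c g : Fin L → Set E}
    (h : IsTouchingChain F c g) (A : RandomizedOnlineAlgorithm.{u} F) :
    (L : ℝ≥0∞) ≤ A.competitiveRatio :=
  A.natCast_le_competitiveRatio (h.isIntersectionGraph_phaseGraph hF)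

end Perturbation

/-! ### Chains from balls -/

/-- A touching chain can be read off from distances between centres when the objects lie between
concentric balls. -/
lemma isTouchingChain_of_dist {E : Type*} [NormedAddCommGroup E] [NormedSpace ℝ E]
    {F : Set (Set E)} {L : ℕ} {c g : Fin L → Set E} {p q : Fin L → E} {r R r' R' : ℝ}
    (hr : 0 < r) (hr' : 0 ≤ r') (hcF : ∀ k, c k ∈ F) (hgF : ∀ i, g i ∈ F)
    (hcc : ∀ k, IsCompact (c k)) (hgc : ∀ i, IsCompact (g i))
    (hrc : ∀ k, Metric.ball (p k) r ⊆ c k) (hcR : ∀ k, c k ⊆ Metric.closedBall (p k) R)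
    (hrg : ∀ i, Metric.closedBall (q i) r' ⊆ g i) (hgR : ∀ i, g i ⊆ Metric.closedBall (q i) R')
    (hqq : ∀ i j, i ≠ j → R' + R' < dist (q i) (q j))
    (hpq : ∀ i k, i < k → R + R' < dist (p k) (q i))
    (hpq' : ∀ k i, k ≤ i → dist (p k) (q i) < r' + r)
    (hpp : ∀ k k', dist (p k) (p k') < r + r) : IsTouchingChain F c g where
  mem_c := hcF
  mem_g := hgF
  isCompact_c := hcc
  isCompact_g := hgc
  disjoint_g i j hij :=
    (Metric.closedBall_disjoint_closedBall (hqq i j hij)).mono (hgR i) (hgR j)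
  disjoint_c_g i k hik :=
    (Metric.closedBall_disjoint_closedBall (hpq i k hik)).mono (hcR k) (hgR i)
  inter_c_g k i hki := by
    obtain ⟨x, hx, hx'⟩ := exists_dist_lt_le hr hr' (hpq' k i hki)
    exact ⟨x, interior_maximal (hrc k) Metric.isOpen_ball (by rwa [Metric.mem_ball, dist_comm]),
      hrg i hx'⟩
  inter_c_c k k' _ := by
    obtain ⟨x, hx, hx'⟩ := exists_dist_lt_lt hr hr (hpp k k')
    exact ⟨x, interior_maximal (hrc k) Metric.isOpen_ball (by rwa [Metric.mem_ball, dist_comm]),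
      hrc k' hx'⟩

/-- The point with coordinates `a j / N`. -/
noncomputable def gridPoint {n : ℕ} (N : ℝ) (a : Fin n → ℤ) : EuclideanSpace ℝ (Fin n) :=
  WithLp.toLp 2 fun j => (a j : ℝ) / N

lemma dist_gridPoint {n : ℕ} {N : ℝ} (hN : 0 < N) (a b : Fin n → ℤ) :
    dist (gridPoint N a) (gridPoint N b) = √((∑ j, (a j - b j) ^ 2 : ℤ) : ℝ) / N := by
  rw [EuclideanSpace.dist_eq]
  have : (∑ j, dist ((gridPoint N a).ofLp j) ((gridPoint N b).ofLp j) ^ 2) =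
      ((∑ j, (a j - b j) ^ 2 : ℤ) : ℝ) / N ^ 2 := by
    rw [Int.cast_sum, Finset.sum_div]
    refine Finset.sum_congr rfl fun j _ => ?_
    simp only [gridPoint, Real.dist_eq, sq_abs]
    push_cast
    rw [← sub_div, div_pow]
  rw [this, Real.sqrt_div' _ (by positivity), Real.sqrt_sq hN.le]

lemma dist_gridPoint_lt {n : ℕ} {N ρ : ℝ} (hN : 0 < N) (hρ : 0 ≤ ρ) {a b : Fin n → ℤ} {T : ℤ}
    (h : ∑ j, (a j - b j) ^ 2 < T) (hT : (T : ℝ) ≤ (ρ * N) ^ 2) :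
    dist (gridPoint N a) (gridPoint N b) < ρ := by
  rw [dist_gridPoint hN, div_lt_iff₀ hN]
  refine (Real.sqrt_lt_sqrt (by positivity) (Int.cast_lt.2 h)).trans_le ?_
  exact Real.sqrt_le_iff.2 ⟨by positivity, hT⟩

lemma lt_dist_gridPoint {n : ℕ} {N ρ : ℝ} (hN : 0 < N) {a b : Fin n → ℤ} {T : ℤ}
    (h : T < ∑ j, (a j - b j) ^ 2) (hT : (ρ * N) ^ 2 ≤ (T : ℝ)) :
    ρ < dist (gridPoint N a) (gridPoint N b) := by
  rw [dist_gridPoint hN, lt_div_iff₀ hN]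
  refine lt_of_le_of_lt ?_ (Real.sqrt_lt_sqrt ((sq_nonneg _).trans hT) (Int.cast_lt.2 h))
  exact Real.le_sqrt_of_sq_le hT

/-! ### Unit balls in space -/

lemma translateSet_closedBall {E : Type*} [NormedAddCommGroup E] (v x : E) (r : ℝ) :
    translateSet v (Metric.closedBall x r) = Metric.closedBall (v + x) r := by
  ext y
  rw [mem_translateSet, Metric.mem_closedBall, Metric.mem_closedBall, dist_eq_norm, dist_eq_norm,
    sub_sub]

/-- Centres of seven pairwise disjoint unit balls, scaled by `5`. -/
def ballLeaf : Fin 7 → Fin 3 → ℤ :=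
  ![![9, -2, 7], ![6, -7, -3], ![-2, -2, 8], ![-4, -5, -3], ![3, 2, -8], ![7, 7, 1], ![-4, 6, 0]]

/-- Centres of seven unit balls, scaled by `5`. The `k`-th of them meets precisely the unit balls
number `k, …, 6` of `ballLeaf`. -/
def ballHub : Fin 7 → Fin 3 → ℤ :=
  ![![3, 0, 1], ![1, 0, -1], ![-1, 3, 0], ![0, 3, -3], ![4, 4, -2], ![4, 7, 3], ![-4, 6, 0]]

theorem seven_le_competitiveRatio_unitBalls
    (A : RandomizedOnlineAlgorithm.{u} (unitBalls 3)) : (7 : ℕ) ≤ A.competitiveRatio := by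
  have h5 : (0 : ℝ) < 5 := by norm_num
  refine IsTouchingChain.natCast_le_competitiveRatio (L := 7)
    (c := fun k => Metric.closedBall (gridPoint 5 (ballHub k)) 1)
    (g := fun k => Metric.closedBall (gridPoint 5 (ballLeaf k)) 1) ?_ ?_ A
  · rintro _ ⟨x, rfl⟩ v
    exact ⟨v + x, translateSet_closedBall v x 1⟩
  · refine isTouchingChain_of_dist (r := 1) (R := 1) (r' := 1) (R' := 1) one_pos zero_le_one
      (fun k => ⟨_, rfl⟩) (fun k => ⟨_, rfl⟩)
      (fun k => isCompact_closedBall _ _) (fun k => isCompact_closedBall _ _)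
      (fun k => Metric.ball_subset_closedBall) (fun k => le_rfl) (fun k => le_rfl)
      (fun k => le_rfl) (fun i j hij => ?_) (fun i k hik => ?_) (fun k i hki => ?_)
      (fun k k' => ?_)
    · have : ∀ i j, i ≠ j → 100 < ∑ l, (ballLeaf i l - ballLeaf j l) ^ 2 := by decide
      exact lt_dist_gridPoint h5 (this i j hij) (by norm_num)
    · have : ∀ i k, i < k → 100 < ∑ l, (ballHub k l - ballLeaf i l) ^ 2 := by decide
      exact lt_dist_gridPoint h5 (this i k hik) (by norm_num)
    · have : ∀ k i, k ≤ i → ∑ l, (ballHub k l - ballLeaf i l) ^ 2 < 100 := by decide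
      exact dist_gridPoint_lt h5 (by norm_num) (this k i hki) (by norm_num)
    · have : ∀ k k', ∑ l, (ballHub k l - ballHub k' l) ^ 2 < 100 := by decide
      exact dist_gridPoint_lt h5 (by norm_num) (this k k') (by norm_num)

/-! ### Translates -/

lemma translateSet_mem_translates {d : ℕ} {K : Set (EuclideanSpace ℝ (Fin d))} :
    ∀ S ∈ translates K, ∀ v, translateSet v S ∈ translates K := by
  rintro _ ⟨w, rfl⟩ v
  exact ⟨v + w, translateSet_translateSet v w K⟩

/-- Affine injections preserve the intersection graphs of translates. -/
lemma IsIntersectionGraph.translates_image {d : ℕ} {K : Set (EuclideanSpace ℝ (Fin d))}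
    {V : Type*} {G : SimpleGraph V} (h : IsIntersectionGraph (translates K) G)
    {f φ : EuclideanSpace ℝ (Fin d) → EuclideanSpace ℝ (Fin d)} (hf : Function.Injective f)
    (hφ : ∀ v x, f (v + x) = φ v + f x) : IsIntersectionGraph (translates (f '' K)) G := by
  refine h.image hf ?_
  rintro _ ⟨v, rfl⟩
  refine ⟨φ v, ?_⟩
  rw [Set.image_image, Set.image_image]
  exact Set.image_congr fun x _ => hφ v x

/-- Similarities preserve the intersection graphs of translates. -/
lemma IsIntersectionGraph.translates_isometry_smul {d : ℕ}
    {K : Set (EuclideanSpace ℝ (Fin d))} {V : Type*} {G : SimpleGraph V}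
    (h : IsIntersectionGraph (translates K) G)
    (e : EuclideanSpace ℝ (Fin d) ≃ᵢ EuclideanSpace ℝ (Fin d)) {r : ℝ} (hr : r ≠ 0) :
    IsIntersectionGraph (translates (e '' ((fun x => r • x) '' K))) G := by
  rw [Set.image_image]
  refine h.translates_image (f := fun x => e (r • x))
    (φ := fun v => e.toRealLinearIsometryEquiv (r • v))
    (e.injective.comp (smul_right_injective _ hr)) fun v x => ?_
  have h1 : ∀ y, e y = e.toRealLinearIsometryEquiv y + e 0 := fun y => by
    rw [IsometryEquiv.toRealLinearIsometryEquiv_apply]; simp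
  rw [h1 (r • (v + x)), h1 (r • x), smul_add, map_add, add_assoc]

/-! ### Regular polygons -/

/-- The regular `k`-gon of circumradius one centred at the origin. -/
def unitPolygon (k : ℕ) : Set (EuclideanSpace ℝ (Fin 2)) :=
  convexHull ℝ (Set.range fun i : Fin k =>
    !₂[Real.cos (2 * Real.pi * (i : ℝ) / k), Real.sin (2 * Real.pi * (i : ℝ) / k)])

lemma isIntersectionGraph_translates_of_isRegularPolygon {k : ℕ}
    {K : Set (EuclideanSpace ℝ (Fin 2))} (hK : IsRegularPolygon k K) {V : Type*}
    {G : SimpleGraph V} (h : IsIntersectionGraph (translates (unitPolygon k)) G) :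
    IsIntersectionGraph (translates K) G := by
  obtain ⟨r, hr, e, rfl⟩ := hK
  have := h.translates_isometry_smul e hr.ne'
  convert this using 4
  rw [unitPolygon, Set.image_smul, ← convexHull_smul, ← Set.image_smul, ← Set.range_comp]
  congr 2
  funext i
  ext j
  fin_cases j <;> simp

lemma isCompact_unitPolygon (k : ℕ) : IsCompact (unitPolygon k) :=
  (Set.finite_range _).isCompact_convexHull ℝ

lemma unitPolygon_subset_closedBall (k : ℕ) : unitPolygon k ⊆ Metric.closedBall 0 1 := by
  refine convexHull_min ?_ (convex_closedBall _ _)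
  rintro _ ⟨i, rfl⟩
  simp [EuclideanSpace.norm_eq]

/-- The inradius of the regular `k`-gon of circumradius one is `cos (π / k)`: in every direction,
some vertex is within an angle of `π / k`. -/
lemma closedBall_subset_unitPolygon {k : ℕ} (hk : 1 ≤ k) :
    Metric.closedBall 0 (Real.cos (Real.pi / k)) ⊆ unitPolygon k := by
  intro x hx
  by_contra hxK
  obtain ⟨f, u, hfu, hux⟩ := geometric_hahn_banach_closed_point (convex_convexHull ℝ _)
    (isCompact_unitPolygon k).isClosed hxK
  have hk0 : (0 : ℝ) < k := by exact_mod_cast hk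
  have hf : ∀ y : EuclideanSpace ℝ (Fin 2), f y = f !₂[1, 0] * y 0 + f !₂[0, 1] * y 1 := by
    intro y
    have : y = y 0 • !₂[(1 : ℝ), 0] + y 1 • !₂[(0 : ℝ), 1] := by
      ext j; fin_cases j <;> simp
    conv_lhs => rw [this, map_add, map_smul, map_smul]
    simp only [smul_eq_mul]; ring
  set z : ℂ := ⟨f !₂[1, 0], f !₂[0, 1]⟩ with hz
  have hre : f !₂[1, 0] = ‖z‖ * Real.cos z.arg := by rw [Complex.norm_mul_cos_arg]
  have him : f !₂[0, 1] = ‖z‖ * Real.sin z.arg := by rw [Complex.norm_mul_sin_arg]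
  -- the vertex closest to the direction of `f`
  set n : ℤ := round (z.arg * k / (2 * Real.pi)) with hn
  have hround : |z.arg - 2 * Real.pi * n / k| ≤ Real.pi / k := by
    have h1 := abs_sub_round (z.arg * k / (2 * Real.pi))
    rw [← hn] at h1
    have h2 : z.arg - 2 * Real.pi * n / k =
        (z.arg * k / (2 * Real.pi) - n) * (2 * Real.pi / k) := by
      field_simp
    rw [h2, abs_mul, abs_of_pos (a := 2 * Real.pi / k) (by positivity)]
    calc _ ≤ 1 / 2 * (2 * Real.pi / k) := by gcongr
      _ = _ := by ring
  have hmod0 : 0 ≤ n % k := Int.emod_nonneg _ (by exact_mod_cast hk0.ne')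
  have hmodk : n % k < k := Int.emod_lt_of_pos _ (by exact_mod_cast hk0)
  obtain ⟨i, hi⟩ := Int.eq_ofNat_of_zero_le hmod0
  have hik : i < k := by rw [hi] at hmodk; exact_mod_cast hmodk
  have hni : (n : ℝ) = i + k * (n / k : ℤ) := by
    have := Int.emod_add_mul_ediv n k
    rw [hi] at this
    exact_mod_cast this.symm
  have hcos : Real.cos (Real.pi / k) ≤ Real.cos (z.arg - 2 * Real.pi * i / k) := by
    have h1 : z.arg - 2 * Real.pi * i / k =
        z.arg - 2 * Real.pi * n / k + (n / k : ℤ) * (2 * Real.pi) := by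
      rw [hni]; field_simp; ring
    rw [h1, Real.cos_add_int_mul_two_pi, ← Real.cos_abs (z.arg - _)]
    refine Real.cos_le_cos_of_nonneg_of_le_pi (abs_nonneg _) ?_ hround
    exact div_le_self Real.pi_pos.le (by exact_mod_cast hk)
  have hv := hfu _ (subset_convexHull ℝ _ ⟨⟨i, hik⟩, rfl⟩)
  rw [hf] at hv hux
  have hx' : x 0 ^ 2 + x 1 ^ 2 ≤ Real.cos (Real.pi / k) ^ 2 := by
    rw [mem_closedBall_zero_iff, EuclideanSpace.norm_eq] at hx
    have h1 := Real.sqrt_le_iff.1 hx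
    simpa [Fin.sum_univ_two] using h1.2
  have hc0 : 0 ≤ Real.cos (Real.pi / k) := by
    rw [mem_closedBall_zero_iff] at hx
    exact (norm_nonneg x).trans hx
  have hcs : Real.cos z.arg * x 0 + Real.sin z.arg * x 1 ≤ Real.cos (Real.pi / k) := by
    refine abs_le_of_sq_le_sq' ?_ hc0 |>.2
    have := Real.sin_sq_add_cos_sq z.arg
    nlinarith [sq_nonneg (Real.cos z.arg * x 1 - Real.sin z.arg * x 0)]
  rw [hre, him] at hv hux
  simp only [Matrix.cons_val_zero, Matrix.cons_val_one] at hv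
  rw [Real.cos_sub] at hcos
  have := mul_le_mul_of_nonneg_left (hcs.trans hcos) (norm_nonneg z)
  linarith

lemma translateSet_mono {E : Type*} [NormedAddCommGroup E] {v : E} {S T : Set E} (h : S ⊆ T) :
    translateSet v S ⊆ translateSet v T := Set.image_mono h

lemma IsCompact.translateSet {E : Type*} [NormedAddCommGroup E] {S : Set E} (h : IsCompact S)
    (v : E) : IsCompact (translateSet v S) :=
  h.image (continuous_const.add continuous_id)

/-- Centres of three pairwise disjoint translates of a regular polygon with at least four
vertices and circumradius one, scaled by `100`. -/
def polygonLeaf : Fin 3 → Fin 2 → ℤ := ![![0, 139], ![101, -40], ![-101, -40]]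

/-- Centres, scaled by `100`, of three translates the `k`-th of which meets precisely the
translates number `k, …, 2` of `polygonLeaf`. -/
def polygonHub : Fin 3 → Fin 2 → ℤ := ![![0, 0], ![0, -62], ![-101, -40]]

lemma exists_isTouchingChain_unitPolygon {k : ℕ} (hk : 4 ≤ k) :
    ∃ c g : Fin 3 → Set (EuclideanSpace ℝ (Fin 2)),
      IsTouchingChain (translates (unitPolygon k)) c g := by
  have h100 : (0 : ℝ) < 100 := by norm_num
  -- the inradius is at least `cos (π / 4) = √2 / 2 > 7 / 10`
  have hin : Metric.closedBall 0 (7 / 10) ⊆ unitPolygon k := by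
    refine (Metric.closedBall_subset_closedBall ?_).trans
      (closedBall_subset_unitPolygon (by omega))
    have h1 : Real.cos (Real.pi / 4) ≤ Real.cos (Real.pi / k) := by
      refine Real.cos_le_cos_of_nonneg_of_le_pi (by positivity) ?_ ?_
      · exact div_le_self Real.pi_pos.le (by norm_num)
      · have : (4 : ℝ) ≤ k := by exact_mod_cast hk
        have := Real.pi_pos
        gcongr
    rw [Real.cos_pi_div_four] at h1
    have : (14 / 10 : ℝ) ≤ √2 := Real.le_sqrt_of_sq_le (by norm_num)
    linarith
  have hball : ∀ v : EuclideanSpace ℝ (Fin 2),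
      Metric.closedBall v (7 / 10) ⊆ translateSet v (unitPolygon k) := fun v => by
    have := translateSet_mono (v := v) hin
    rwa [translateSet_closedBall, add_zero] at this
  have hball' : ∀ v : EuclideanSpace ℝ (Fin 2),
      translateSet v (unitPolygon k) ⊆ Metric.closedBall v 1 := fun v => by
    have := translateSet_mono (v := v) (unitPolygon_subset_closedBall k)
    rwa [translateSet_closedBall, add_zero] at this
  refine ⟨fun i => translateSet (gridPoint 100 (polygonHub i)) (unitPolygon k),
    fun i => translateSet (gridPoint 100 (polygonLeaf i)) (unitPolygon k),
    isTouchingChain_of_dist (r := 7 / 10) (R := 1) (r' := 7 / 10) (R' := 1)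
      (by norm_num) (by norm_num) (fun i => ⟨_, rfl⟩) (fun i => ⟨_, rfl⟩)
      (fun i => (isCompact_unitPolygon k).translateSet _)
      (fun i => (isCompact_unitPolygon k).translateSet _)
      (fun i => Metric.ball_subset_closedBall.trans (hball _)) (fun i => hball' _)
      (fun i => hball _) (fun i => hball' _) (fun i j hij => ?_) (fun i k hik => ?_)
      (fun k i hki => ?_) (fun k k' => ?_)⟩
  · have : ∀ i j, i ≠ j → 40000 < ∑ l, (polygonLeaf i l - polygonLeaf j l) ^ 2 := by decide
    exact lt_dist_gridPoint h100 (this i j hij) (by norm_num)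
  · have : ∀ i k, i < k → 40000 < ∑ l, (polygonHub k l - polygonLeaf i l) ^ 2 := by decide
    exact lt_dist_gridPoint h100 (this i k hik) (by norm_num)
  · have : ∀ k i, k ≤ i → ∑ l, (polygonHub k l - polygonLeaf i l) ^ 2 < 19600 := by decide
    exact dist_gridPoint_lt h100 (by norm_num) (this k i hki) (by norm_num)
  · have : ∀ k k', ∑ l, (polygonHub k l - polygonHub k' l) ^ 2 < 19600 := by decide
    exact dist_gridPoint_lt h100 (by norm_num) (this k k') (by norm_num)

/-! ### Triangles -/

/-- The triangle with vertices `(0, 0)`, `(1, 0)` and `(0, 1)`. -/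
def rightTriangle : Set (EuclideanSpace ℝ (Fin 2)) :=
  {x | 0 ≤ x 0 ∧ 0 ≤ x 1 ∧ x 0 + x 1 ≤ 1}

lemma continuous_coord {n : ℕ} (i : Fin n) :
    Continuous fun x : EuclideanSpace ℝ (Fin n) => x i := by fun_prop

lemma rightTriangle_eq_convexHull :
    rightTriangle = convexHull ℝ (Set.range ![!₂[(1 : ℝ), 0], !₂[0, 1], !₂[0, 0]]) := by
  apply Set.Subset.antisymm
  · rintro x ⟨h0, h1, h2⟩
    refine mem_convexHull_of_exists_fintype ![x 0, x 1, 1 - x 0 - x 1]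
      ![!₂[(1 : ℝ), 0], !₂[0, 1], !₂[0, 0]] ?_ ?_ (fun i => ⟨i, rfl⟩) ?_
    · intro i
      fin_cases i <;> simp <;> linarith
    · simp [Fin.sum_univ_three]
    · ext j
      fin_cases j <;> simp [Fin.sum_univ_three]
  · refine convexHull_min ?_ ?_
    · rintro _ ⟨i, rfl⟩
      fin_cases i <;> simp [rightTriangle]
    · rintro x ⟨hx0, hx1, hx2⟩ y ⟨hy0, hy1, hy2⟩ a b ha hb hab
      refine ⟨?_, ?_, ?_⟩ <;> simp only [PiLp.add_apply, PiLp.smul_apply, smul_eq_mul]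
      · positivity
      · positivity
      · nlinarith

lemma isCompact_rightTriangle : IsCompact rightTriangle := by
  rw [rightTriangle_eq_convexHull]
  exact (Set.finite_range _).isCompact_convexHull ℝ

/-- Two translates of the triangle are disjoint if their difference is outside of the hexagon
`|x| ≤ 1, |y| ≤ 1, |x + y| ≤ 1`. -/
lemma disjoint_translateSet_rightTriangle {v w : EuclideanSpace ℝ (Fin 2)}
    (h : 1 < |v 0 - w 0| ∨ 1 < |v 1 - w 1| ∨ 1 < |(v 0 - w 0) + (v 1 - w 1)|) :
    Disjoint (translateSet v rightTriangle) (translateSet w rightTriangle) := by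
  rw [Set.disjoint_left]
  intro x hx hx'
  rw [mem_translateSet] at hx hx'
  obtain ⟨a0, a1, a2⟩ := hx
  obtain ⟨b0, b1, b2⟩ := hx'
  simp only [PiLp.sub_apply] at a0 a1 a2 b0 b1 b2
  rcases h with h | h | h
  · exact absurd h (not_lt.2 (abs_le.2 ⟨by linarith, by linarith⟩))
  · exact absurd h (not_lt.2 (abs_le.2 ⟨by linarith, by linarith⟩))
  · exact absurd h (not_lt.2 (abs_le.2 ⟨by linarith, by linarith⟩))

/-- Two translates of the triangle overlap if their difference is in the interior of the
hexagon. -/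
lemma interior_translateSet_rightTriangle_inter {v w : EuclideanSpace ℝ (Fin 2)}
    (h0 : |v 0 - w 0| < 1) (h1 : |v 1 - w 1| < 1) (h2 : |(v 0 - w 0) + (v 1 - w 1)| < 1) :
    (interior (translateSet v rightTriangle) ∩ translateSet w rightTriangle).Nonempty := by
  rw [abs_lt] at h0 h1 h2
  obtain ⟨a, b, ha, hb, hab, ha', hb', hab'⟩ : ∃ a b : ℝ, v 0 < a ∧ v 1 < b ∧
      a + b < v 0 + v 1 + 1 ∧ w 0 < a ∧ w 1 < b ∧ a + b < w 0 + w 1 + 1 := by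
    obtain ⟨η, hη, hη'⟩ := exists_between (show
      max (v 0) (w 0) + max (v 1) (w 1) < min (v 0 + v 1) (w 0 + w 1) + 1 by
        rcases max_cases (v 0) (w 0) with h | h <;> rcases max_cases (v 1) (w 1) with h' | h' <;>
          rcases min_cases (v 0 + v 1) (w 0 + w 1) with h'' | h'' <;> linarith)
    set δ := (η - (max (v 0) (w 0) + max (v 1) (w 1))) / 2 with hδ
    have hδ0 : 0 < δ := by rw [hδ]; linarith
    have e1 := le_max_left (v 0) (w 0)
    have e2 := le_max_right (v 0) (w 0)
    have e3 := le_max_left (v 1) (w 1)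
    have e4 := le_max_right (v 1) (w 1)
    have e5 := min_le_left (v 0 + v 1) (w 0 + w 1)
    have e6 := min_le_right (v 0 + v 1) (w 0 + w 1)
    exact ⟨max (v 0) (w 0) + δ, max (v 1) (w 1) + δ, by linarith, by linarith, by linarith,
      by linarith, by linarith, by linarith⟩
  refine ⟨!₂[a, b], ?_, ?_⟩
  · refine interior_maximal (t := {x | v 0 < x 0 ∧ v 1 < x 1 ∧ x 0 + x 1 < v 0 + v 1 + 1})
      ?_ ?_ ?_
    · rintro x ⟨hx0, hx1, hx2⟩
      rw [mem_translateSet]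
      refine ⟨?_, ?_, ?_⟩ <;> simp only [PiLp.sub_apply] <;> linarith
    · exact (isOpen_lt continuous_const (continuous_coord 0)).inter
        ((isOpen_lt continuous_const (continuous_coord 1)).inter
          (isOpen_lt ((continuous_coord 0).add (continuous_coord 1)) continuous_const))
    · exact ⟨by simpa using ha, by simpa using hb, by simpa using hab⟩
  · rw [mem_translateSet]
    refine ⟨?_, ?_, ?_⟩ <;> simp <;> linarith

/-- Positions, scaled by `10`, of three pairwise disjoint translates of a triangle. -/
def triangleLeaf : Fin 3 → Fin 2 → ℤ := ![![9, 0], ![-9, 9], ![0, -9]]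

/-- Positions, scaled by `10`, of three translates of a triangle the `k`-th of which meets
precisely the translates number `k, …, 2` of `triangleLeaf`. -/
def triangleHub : Fin 3 → Fin 2 → ℤ := ![![0, 0], ![-2, 0], ![0, -9]]

lemma gridPoint_sub_apply {n : ℕ} (N : ℝ) (a b : Fin n → ℤ) (i : Fin n) :
    gridPoint N a i - gridPoint N b i = ((a i - b i : ℤ) : ℝ) / N := by
  simp only [gridPoint]
  push_cast
  rw [sub_div]

lemma disjoint_gridPoint_rightTriangle {a b : Fin 2 → ℤ}
    (h : 10 < |a 0 - b 0| ∨ 10 < |a 1 - b 1| ∨ 10 < |(a 0 - b 0) + (a 1 - b 1)|) :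
    Disjoint (translateSet (gridPoint 10 a) rightTriangle)
      (translateSet (gridPoint 10 b) rightTriangle) := by
  apply disjoint_translateSet_rightTriangle
  have key : ∀ n : ℤ, 10 < |n| → (1 : ℝ) < |(n : ℝ) / 10| := fun n hn => by
    rw [abs_div, abs_of_pos (a := (10 : ℝ)) (by norm_num), lt_div_iff₀ (by norm_num), one_mul]
    exact_mod_cast hn
  simp only [gridPoint_sub_apply]
  rw [← add_div, ← Int.cast_add]
  exact h.imp (key _) (Or.imp (key _) (key _))

lemma interior_gridPoint_rightTriangle_inter {a b : Fin 2 → ℤ}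
    (h : |a 0 - b 0| < 10 ∧ |a 1 - b 1| < 10 ∧ |(a 0 - b 0) + (a 1 - b 1)| < 10) :
    (interior (translateSet (gridPoint 10 a) rightTriangle) ∩
      translateSet (gridPoint 10 b) rightTriangle).Nonempty := by
  have key : ∀ n : ℤ, |n| < 10 → |(n : ℝ) / 10| < 1 := fun n hn => by
    rw [abs_div, abs_of_pos (a := (10 : ℝ)) (by norm_num), div_lt_iff₀ (by norm_num), one_mul]
    exact_mod_cast hn
  apply interior_translateSet_rightTriangle_inter <;> simp only [gridPoint_sub_apply]
  · exact key _ h.1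
  · exact key _ h.2.1
  · rw [← add_div, ← Int.cast_add]
    exact key _ h.2.2

lemma isTouchingChain_rightTriangle :
    IsTouchingChain (translates rightTriangle)
      (fun k => translateSet (gridPoint 10 (triangleHub k)) rightTriangle)
      (fun k => translateSet (gridPoint 10 (triangleLeaf k)) rightTriangle) where
  mem_c k := ⟨_, rfl⟩
  mem_g k := ⟨_, rfl⟩
  isCompact_c k := isCompact_rightTriangle.translateSet _
  isCompact_g k := isCompact_rightTriangle.translateSet _
  disjoint_g i j hij := disjoint_gridPoint_rightTriangle (by revert i j; decide)
  disjoint_c_g i k hik := disjoint_gridPoint_rightTriangle (by revert i k; decide)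
  inter_c_g k i hki := interior_gridPoint_rightTriangle_inter (by revert k i; decide)
  inter_c_c k k' hk := interior_gridPoint_rightTriangle_inter (by revert k k'; decide)

/-- The equilateral triangle is an affine image of the right triangle. -/
lemma isIntersectionGraph_unitPolygon_three {V : Type*} {G : SimpleGraph V}
    (h : IsIntersectionGraph (translates rightTriangle) G) :
    IsIntersectionGraph (translates (unitPolygon 3)) G := by
  have c1 : Real.cos (2 * Real.pi / 3) = -(1 / 2) := by
    rw [show 2 * Real.pi / 3 = Real.pi - Real.pi / 3 by ring, Real.cos_pi_sub,
      Real.cos_pi_div_three]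
  have s1 : Real.sin (2 * Real.pi / 3) = √3 / 2 := by
    rw [show 2 * Real.pi / 3 = Real.pi - Real.pi / 3 by ring, Real.sin_pi_sub,
      Real.sin_pi_div_three]
  have c2 : Real.cos (2 * Real.pi * 2 / 3) = -(1 / 2) := by
    rw [show 2 * Real.pi * 2 / 3 = Real.pi / 3 + Real.pi by ring, Real.cos_add_pi,
      Real.cos_pi_div_three]
  have s2 : Real.sin (2 * Real.pi * 2 / 3) = -(√3 / 2) := by
    rw [show 2 * Real.pi * 2 / 3 = Real.pi / 3 + Real.pi by ring, Real.sin_add_pi,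
      Real.sin_pi_div_three]
  let φ : EuclideanSpace ℝ (Fin 2) →ₗ[ℝ] EuclideanSpace ℝ (Fin 2) :=
    { toFun := fun x => !₂[3 / 2 * x 0, √3 / 2 * x 0 + √3 * x 1]
      map_add' := fun x y => by ext j; fin_cases j <;> simp <;> ring
      map_smul' := fun a x => by ext j; fin_cases j <;> simp <;> ring }
  let b : EuclideanSpace ℝ (Fin 2) := !₂[-(1 / 2), -(√3 / 2)]
  let f : EuclideanSpace ℝ (Fin 2) →ᵃ[ℝ] EuclideanSpace ℝ (Fin 2) :=
    φ.toAffineMap + AffineMap.const ℝ _ b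
  have hfx : ∀ x, f x = φ x + b := fun x => rfl
  have hinj : Function.Injective f := by
    intro x y hxy
    rw [hfx, hfx] at hxy
    have hφ : φ x = φ y := add_right_cancel hxy
    have e0 : 3 / 2 * x 0 = 3 / 2 * y 0 := congrArg (fun z : EuclideanSpace ℝ (Fin 2) => z 0) hφ
    have e1 : √3 / 2 * x 0 + √3 * x 1 = √3 / 2 * y 0 + √3 * y 1 :=
      congrArg (fun z : EuclideanSpace ℝ (Fin 2) => z 1) hφ
    have h0 : x 0 = y 0 := by linarith
    rw [h0] at e1
    have h1 : x 1 = y 1 :=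
      mul_left_cancel₀ (Real.sqrt_ne_zero'.2 (by norm_num : (0 : ℝ) < 3)) (add_left_cancel e1)
    ext j
    fin_cases j
    · exact h0
    · exact h1
  have himg : f '' rightTriangle = unitPolygon 3 := by
    rw [rightTriangle_eq_convexHull, AffineMap.image_convexHull, unitPolygon, ← Set.range_comp]
    congr 2
    funext i
    rw [Function.comp_apply, hfx]
    ext j
    fin_cases i <;> fin_cases j <;> simp [φ, b, c1, s1, c2, s2] <;> ring
  rw [← himg]
  refine h.translates_image (φ := φ) hinj fun v x => ?_
  rw [hfx, hfx, map_add, add_assoc]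

theorem three_le_competitiveRatio_isRegularPolygon {k : ℕ} (hk : 3 ≤ k)
    {K : Set (EuclideanSpace ℝ (Fin 2))} (hK : IsRegularPolygon k K)
    (A : RandomizedOnlineAlgorithm.{u} (translates K)) : (3 : ℕ) ≤ A.competitiveRatio := by
  refine A.natCast_le_competitiveRatio fun m s =>
    isIntersectionGraph_translates_of_isRegularPolygon hK ?_
  rcases hk.eq_or_lt with rfl | hk
  · exact isIntersectionGraph_unitPolygon_three
      (isTouchingChain_rightTriangle.isIntersectionGraph_phaseGraph translateSet_mem_translates m s)
  · obtain ⟨c, g, h⟩ := exists_isTouchingChain_unitPolygon hk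
    exact h.isIntersectionGraph_phaseGraph translateSet_mem_translates m s

/-! ### Hypercubes -/

/-- The unit cube `[0, 1]^d`. -/
def unitCube (d : ℕ) : Set (EuclideanSpace ℝ (Fin d)) := {x | ∀ i, x i ∈ Set.Icc (0 : ℝ) 1}

lemma isCompact_unitCube (d : ℕ) : IsCompact (unitCube d) := by
  have h : IsCompact (Set.univ.pi fun _ : Fin d => Set.Icc (0 : ℝ) 1) :=
    isCompact_univ_pi fun _ => isCompact_Icc
  convert h.image (PiLp.continuous_toLp 2 fun _ : Fin d => ℝ) using 1
  ext x
  constructor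
  · intro hx
    exact ⟨x.ofLp, fun i _ => hx i, rfl⟩
  · rintro ⟨y, hy, rfl⟩ i
    exact hy i trivial

lemma smul_image_unitCube {d : ℕ} {a : ℝ} (ha : 0 < a) :
    (fun x => a • x) '' unitCube d = {x | ∀ i, x i ∈ Set.Icc 0 a} := by
  ext x
  constructor
  · rintro ⟨y, hy, rfl⟩ i
    have := hy i
    exact ⟨mul_nonneg ha.le this.1, mul_le_of_le_one_right ha.le this.2⟩
  · intro hx
    refine ⟨a⁻¹ • x, fun i => ?_, by simp [smul_smul, ha.ne']⟩
    have := hx i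
    exact ⟨mul_nonneg (inv_nonneg.2 ha.le) this.1, by
      simpa [inv_mul_le_iff₀ ha] using this.2⟩

lemma isIntersectionGraph_translates_of_isHypercube {d : ℕ}
    {K : Set (EuclideanSpace ℝ (Fin d))} (hK : IsHypercube K) {V : Type*}
    {G : SimpleGraph V} (h : IsIntersectionGraph (translates (unitCube d)) G) :
    IsIntersectionGraph (translates K) G := by
  obtain ⟨a, ha, e, rfl⟩ := hK
  rw [← smul_image_unitCube ha]
  exact h.translates_isometry_smul e ha.ne'

lemma isIntersectionGraph_congruentCopies_of_isHypercube {d : ℕ}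
    {K : Set (EuclideanSpace ℝ (Fin d))} (hK : IsHypercube K) {V : Type*}
    {G : SimpleGraph V} (h : IsIntersectionGraph (congruentCopies (unitCube d)) G) :
    IsIntersectionGraph (congruentCopies K) G := by
  obtain ⟨a, ha, e, rfl⟩ := hK
  rw [← smul_image_unitCube ha]
  refine h.image (f := fun x => a • x) (smul_right_injective _ ha.ne') ?_
  rintro _ ⟨e', rfl⟩
  -- conjugation with a homothety turns isometries into isometries
  refine ⟨e.symm.trans (IsometryEquiv.mk' (fun x => a • e' (a⁻¹ • x))
    (fun x => a • e'.symm (a⁻¹ • x)) (fun x => ?_) (Isometry.of_dist_eq fun x y => ?_)), ?_⟩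
  · simp [smul_smul, ha.ne']
  · rw [dist_smul₀, e'.isometry.dist_eq, dist_smul₀, ← mul_assoc, ← norm_mul,
      mul_inv_cancel₀ ha.ne', norm_one, one_mul]
  · simp only [Set.image_image]
    refine Set.image_congr fun x _ => ?_
    simp [IsometryEquiv.mk', smul_smul, ha.ne']

lemma disjoint_translateSet_unitCube {d : ℕ} {v w : EuclideanSpace ℝ (Fin d)} {i : Fin d}
    (h : 1 < |v i - w i|) :
    Disjoint (translateSet v (unitCube d)) (translateSet w (unitCube d)) := by
  rw [Set.disjoint_left]
  intro x hx hx'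
  rw [mem_translateSet] at hx hx'
  obtain ⟨a0, a1⟩ := hx i
  obtain ⟨b0, b1⟩ := hx' i
  rw [PiLp.sub_apply] at a0 a1 b0 b1
  exact absurd h (not_lt.2 (abs_le.2 ⟨by linarith, by linarith⟩))

lemma interior_translateSet_unitCube_inter {d : ℕ} {v w : EuclideanSpace ℝ (Fin d)}
    (h : ∀ i, |v i - w i| < 1) :
    (interior (translateSet v (unitCube d)) ∩ translateSet w (unitCube d)).Nonempty := by
  have h' := fun i => abs_lt.1 (h i)
  refine ⟨WithLp.toLp 2 fun i => (v i + w i + 1) / 2, ?_, ?_⟩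
  · refine interior_maximal (t := {x | ∀ i, v i < x i ∧ x i < v i + 1}) ?_ ?_ ?_
    · intro x hx
      rw [mem_translateSet]
      intro i
      obtain ⟨h1, h2⟩ := hx i
      rw [PiLp.sub_apply]
      exact ⟨by linarith, by linarith⟩
    · rw [Set.ofPred_forall]
      exact isOpen_iInter_of_finite fun i =>
        (isOpen_lt continuous_const (continuous_coord i)).inter
          (isOpen_lt (continuous_coord i) continuous_const)
    · intro i
      obtain ⟨h1, h2⟩ := h' i
      constructor <;> simp only <;> linarith
  · rw [mem_translateSet]
    intro i
    obtain ⟨h1, h2⟩ := h' i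
    rw [PiLp.sub_apply]
    constructor <;> simp only <;> linarith

/-! ### Positions from binary digits -/

/-- If two numbers differ only in their last `r` binary digits, then the smaller one has a zero
at the first position where they differ. -/
lemma exists_digit_of_lt {a b : ℕ} (hab : a < b) (r : ℕ) (h : a / 2 ^ r = b / 2 ^ r) :
    ∃ i < r, a / 2 ^ i % 2 = 0 ∧ b / 2 ^ i % 2 = 1 ∧ a / 2 ^ i < b / 2 ^ i := by
  induction r with
  | zero => simp at h; omega
  | succ r ih =>
    by_cases hr : a / 2 ^ r = b / 2 ^ r
    · obtain ⟨i, hi, hi'⟩ := ih hr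
      exact ⟨i, by omega, hi'⟩
    · have hle : a / 2 ^ r ≤ b / 2 ^ r := Nat.div_le_div_right hab.le
      rw [pow_succ, ← Nat.div_div_eq_div_mul, ← Nat.div_div_eq_div_mul] at h
      exact ⟨r, by omega, by omega, by omega, by omega⟩

/-- The `i`-th coordinate of the hub number `k`: a small multiple of `k` without its last `i`
binary digits. All these coordinates increase with `k`. -/
noncomputable def hubCoord (ε : ℝ) (k i : ℕ) : ℝ := ε * (k / 2 ^ i : ℕ)

/-- The `i`-th coordinate of the leaf number `N`. The `i`-th binary digit of `N` decides about its
sign. If it is negative, then the hubs number `k` within distance one in this coordinate are those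
for which `k` does not exceed `N` after deletion of the last `i` binary digits. -/
noncomputable def leafCoord (ε : ℝ) (N i : ℕ) : ℝ :=
  if N / 2 ^ i % 2 = 0 then ε * ((N / 2 ^ i : ℕ) + 1 / 2) - 1 else 1 / 2

lemma mul_natDiv_le {ε : ℝ} (hε : 0 < ε) {B : ℕ} (hB : ε * B ≤ 1 / 2) {a : ℕ} (ha : a < B)
    (i : ℕ) : ε * ((a / 2 ^ i : ℕ) + 1) ≤ 1 / 2 := by
  refine le_trans (mul_le_mul_of_nonneg_left ?_ hε.le) hB
  have : a / 2 ^ i + 1 ≤ B := (Nat.div_le_self _ _).trans_lt ha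
  exact_mod_cast this

lemma one_lt_abs_leafCoord_sub {ε : ℝ} (hε : 0 < ε) {B : ℕ} (hB : ε * B ≤ 1 / 2) {a b : ℕ}
    (ha : a < B) (hb : b < B) (hab : a ≠ b) {r : ℕ} (h : a / 2 ^ r = b / 2 ^ r) :
    ∃ i < r, 1 < |leafCoord ε a i - leafCoord ε b i| := by
  wlog hlt : a < b generalizing a b
  · obtain ⟨i, hi, hi'⟩ := this hb ha hab.symm h.symm (by omega)
    exact ⟨i, hi, by rwa [abs_sub_comm]⟩
  obtain ⟨i, hi, h0, h1, -⟩ := exists_digit_of_lt hlt r h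
  refine ⟨i, hi, ?_⟩
  have := mul_natDiv_le hε hB ha i
  rw [leafCoord, leafCoord, if_pos h0, if_neg (by omega), lt_abs]
  right
  linarith

lemma one_lt_abs_hubCoord_sub_leafCoord {ε : ℝ} (hε : 0 < ε) {a k : ℕ} (hak : a < k) {r : ℕ}
    (h : a / 2 ^ r = k / 2 ^ r) : ∃ i < r, 1 < |hubCoord ε k i - leafCoord ε a i| := by
  obtain ⟨i, hi, h0, -, h1⟩ := exists_digit_of_lt hak r h
  refine ⟨i, hi, ?_⟩
  rw [hubCoord, leafCoord, if_pos h0, lt_abs]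
  left
  have : ((a / 2 ^ i : ℕ) : ℝ) + 1 ≤ (k / 2 ^ i : ℕ) := by exact_mod_cast h1
  have := mul_le_mul_of_nonneg_left this hε.le
  linarith

lemma abs_hubCoord_sub_leafCoord_lt {ε : ℝ} (hε : 0 < ε) {B : ℕ} (hB : ε * B ≤ 1 / 2) {a k : ℕ}
    (ha : a < B) (hka : k ≤ a) (i : ℕ) : |hubCoord ε k i - leafCoord ε a i| < 1 := by
  have h0 : ((k / 2 ^ i : ℕ) : ℝ) ≤ (a / 2 ^ i : ℕ) := by
    exact_mod_cast Nat.div_le_div_right hka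
  have h1 := mul_natDiv_le hε hB ha i
  have h2 := mul_le_mul_of_nonneg_left h0 hε.le
  have h3 : 0 ≤ ε * (k / 2 ^ i : ℕ) := mul_nonneg hε.le (Nat.cast_nonneg _)
  rw [hubCoord, leafCoord, abs_lt]
  split_ifs
  · constructor <;> linarith
  · constructor <;> linarith

lemma abs_hubCoord_sub_hubCoord_lt {ε : ℝ} (hε : 0 < ε) {B : ℕ} (hB : ε * B ≤ 1 / 2) {k k' : ℕ}
    (hk : k < B) (hk' : k' < B) (i : ℕ) : |hubCoord ε k i - hubCoord ε k' i| < 1 := by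
  have h1 := mul_natDiv_le hε hB hk i
  have h2 := mul_natDiv_le hε hB hk' i
  have h3 : 0 ≤ ε * (k / 2 ^ i : ℕ) := mul_nonneg hε.le (Nat.cast_nonneg _)
  have h4 : 0 ≤ ε * (k' / 2 ^ i : ℕ) := mul_nonneg hε.le (Nat.cast_nonneg _)
  rw [hubCoord, hubCoord, abs_lt]
  constructor <;> linarith

lemma exists_pos_mul_le_half (B : ℕ) : ∃ ε : ℝ, 0 < ε ∧ ε * B ≤ 1 / 2 := by
  refine ⟨1 / (2 * (B + 1)), by positivity, ?_⟩
  rw [div_mul_eq_mul_div, div_le_div_iff₀ (by positivity) (by positivity)]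
  linarith

lemma exists_isTouchingChain_translates_unitCube (d : ℕ) :
    ∃ c g : Fin (2 ^ d) → Set (EuclideanSpace ℝ (Fin d)),
      IsTouchingChain (translates (unitCube d)) c g := by
  obtain ⟨ε, hε, hB⟩ := exists_pos_mul_le_half (2 ^ d)
  have hdiv : ∀ a b : Fin (2 ^ d), a.1 / 2 ^ d = b.1 / 2 ^ d := fun a b => by
    rw [Nat.div_eq_of_lt a.2, Nat.div_eq_of_lt b.2]
  refine ⟨fun k => translateSet (WithLp.toLp 2 fun i => hubCoord ε k i) (unitCube d),
    fun N => translateSet (WithLp.toLp 2 fun i => leafCoord ε N i) (unitCube d), ?_⟩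
  exact
  { mem_c := fun k => ⟨_, rfl⟩
    mem_g := fun k => ⟨_, rfl⟩
    isCompact_c := fun k => (isCompact_unitCube d).translateSet _
    isCompact_g := fun k => (isCompact_unitCube d).translateSet _
    disjoint_g := fun i j hij => by
      obtain ⟨l, hl, h⟩ := one_lt_abs_leafCoord_sub hε hB i.2 j.2 (Fin.val_ne_of_ne hij)
        (hdiv i j)
      exact disjoint_translateSet_unitCube (i := ⟨l, hl⟩) h
    disjoint_c_g := fun i k hik => by
      obtain ⟨l, hl, h⟩ := one_lt_abs_hubCoord_sub_leafCoord hε hik (hdiv i k)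
      exact disjoint_translateSet_unitCube (i := ⟨l, hl⟩) h
    inter_c_g := fun k i hki => interior_translateSet_unitCube_inter fun l =>
      abs_hubCoord_sub_leafCoord_lt hε hB i.2 hki l
    inter_c_c := fun k k' _ => interior_translateSet_unitCube_inter fun l =>
      abs_hubCoord_sub_hubCoord_lt hε hB k.2 k'.2 l }

theorem two_pow_le_competitiveRatio_translates {d : ℕ} (hd : 1 ≤ d)
    {K : Set (EuclideanSpace ℝ (Fin d))} (hK : IsHypercube K)
    (A : RandomizedOnlineAlgorithm.{u} (translates K)) : (2 ^ d : ℕ) ≤ A.competitiveRatio := by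
  obtain ⟨n, rfl⟩ := Nat.exists_eq_add_of_le' hd
  obtain ⟨c, g, h⟩ := exists_isTouchingChain_translates_unitCube (n + 1)
  exact A.natCast_le_competitiveRatio fun m s => isIntersectionGraph_translates_of_isHypercube hK
    (h.isIntersectionGraph_phaseGraph translateSet_mem_translates m s)

/-! ### Congruent hypercubes -/

/-- The point of `ℝ^(n+2)` with the given first two coordinates and remaining coordinates. -/
noncomputable def splitPoint {n : ℕ} (a b : ℝ) (f : Fin n → ℝ) :
    EuclideanSpace ℝ (Fin (n + 2)) := WithLp.toLp 2 (Fin.cons a (Fin.cons b f))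

@[simp] lemma splitPoint_zero {n : ℕ} (a b : ℝ) (f : Fin n → ℝ) : splitPoint a b f 0 = a := rfl

@[simp] lemma splitPoint_one {n : ℕ} (a b : ℝ) (f : Fin n → ℝ) : splitPoint a b f 1 = b := rfl

@[simp] lemma splitPoint_succ_succ {n : ℕ} (a b : ℝ) (f : Fin n → ℝ) (i : Fin n) :
    splitPoint a b f i.succ.succ = f i := rfl

lemma forall_fin_add_two {n : ℕ} {P : Fin (n + 2) → Prop} :
    (∀ i, P i) ↔ P 0 ∧ P 1 ∧ ∀ i : Fin n, P i.succ.succ := by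
  rw [Fin.forall_fin_succ, Fin.forall_fin_succ, Fin.succ_zero_eq_one]

lemma two_mul_half_sqrt_two_mul_self : 2 * (√2 / 2 * (√2 / 2)) = 1 := by
  have := Real.mul_self_sqrt (show (0 : ℝ) ≤ 2 by norm_num)
  linarith

/-- The reflection of the plane of the first two coordinates which turns axis-parallel squares
into squares with diagonals parallel to the axes. -/
noncomputable def planeReflection (n : ℕ) :
    EuclideanSpace ℝ (Fin (n + 2)) ≃ᵢ EuclideanSpace ℝ (Fin (n + 2)) :=
  IsometryEquiv.mk'
    (fun x => splitPoint (√2 / 2 * (x 0 + x 1)) (√2 / 2 * (x 0 - x 1)) fun i => x i.succ.succ)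
    (fun x => splitPoint (√2 / 2 * (x 0 + x 1)) (√2 / 2 * (x 0 - x 1)) fun i => x i.succ.succ)
    (fun x => by
      ext i
      revert i
      rw [forall_fin_add_two]
      have := two_mul_half_sqrt_two_mul_self
      refine ⟨?_, ?_, fun i => rfl⟩
      · simp only [splitPoint_zero, splitPoint_one]
        linear_combination this * x 0
      · simp only [splitPoint_zero, splitPoint_one]
        linear_combination this * x 1)
    (Isometry.of_dist_eq fun x y => by
      rw [EuclideanSpace.dist_eq, EuclideanSpace.dist_eq]
      congr 1
      simp only [Fin.sum_univ_succ (n := n + 1), Fin.sum_univ_succ (n := n),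
        Fin.succ_zero_eq_one, splitPoint_zero, splitPoint_one, splitPoint_succ_succ,
        Real.dist_eq, sq_abs]
      have := two_mul_half_sqrt_two_mul_self
      linear_combination this * ((x 0 - y 0) ^ 2 + (x 1 - y 1) ^ 2))

/-- The unit cube with its first two coordinates rotated by `45°`, whose projection to the plane of
these coordinates has its centre at the origin. -/
noncomputable def diamondCube (n : ℕ) : Set (EuclideanSpace ℝ (Fin (n + 2))) :=
  {x | (|x 0 + x 1| ≤ √2 / 2 ∧ |x 0 - x 1| ≤ √2 / 2) ∧
    ∀ i : Fin n, x i.succ.succ ∈ Set.Icc (0 : ℝ) 1}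

lemma diamondCube_eq (n : ℕ) : diamondCube n =
    translateSet (splitPoint (-(√2 / 2)) 0 fun _ => 0) (planeReflection n '' unitCube (n + 2)) := by
  have hr : 0 < √2 / 2 := by positivity
  have h2 := two_mul_half_sqrt_two_mul_self
  ext x
  rw [mem_translateSet, ← IsometryEquiv.preimage_symm, Set.mem_preimage]
  have e : ∀ y : EuclideanSpace ℝ (Fin (n + 2)), (planeReflection n).symm y =
    splitPoint (√2 / 2 * (y 0 + y 1)) (√2 / 2 * (y 0 - y 1)) fun i => y i.succ.succ := fun _ => rfl
  rw [e, unitCube, Set.mem_ofPred_eq, forall_fin_add_two, diamondCube, Set.mem_ofPred_eq]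
  simp only [splitPoint_zero, splitPoint_one, splitPoint_succ_succ, PiLp.sub_apply, sub_zero,
    and_assoc]
  have key : ∀ t : ℝ, |t| ≤ √2 / 2 ↔ √2 / 2 * (t + √2 / 2) ∈ Set.Icc (0 : ℝ) 1 := fun t => by
    rw [abs_le, Set.mem_Icc, mul_nonneg_iff_of_pos_left hr]
    refine and_congr ⟨fun h => by linarith, fun h => by linarith⟩ ?_
    rw [show √2 / 2 * (t + √2 / 2) ≤ 1 ↔ √2 / 2 * (t + √2 / 2) ≤ √2 / 2 * (√2 / 2 + √2 / 2) by
      rw [show √2 / 2 * (√2 / 2 + √2 / 2) = 1 by linarith], mul_le_mul_iff_right₀ hr]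
    exact ⟨fun h => by linarith, fun h => by linarith⟩
  rw [key, key]
  ring_nf

lemma translateSet_mem_congruentCopies {d : ℕ} {K : Set (EuclideanSpace ℝ (Fin d))} :
    ∀ S ∈ congruentCopies K, ∀ v, translateSet v S ∈ congruentCopies K := by
  rintro _ ⟨e, rfl⟩ v
  refine ⟨e.trans (IsometryEquiv.addLeft v), ?_⟩
  rw [translateSet, Set.image_image]
  rfl

lemma translateSet_unitCube_mem {d : ℕ} (v : EuclideanSpace ℝ (Fin d)) :
    translateSet v (unitCube d) ∈ congruentCopies (unitCube d) :=
  ⟨IsometryEquiv.addLeft v, rfl⟩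

lemma translateSet_diamondCube_mem {n : ℕ} (v : EuclideanSpace ℝ (Fin (n + 2))) :
    translateSet v (diamondCube n) ∈ congruentCopies (unitCube (n + 2)) := by
  rw [diamondCube_eq]
  exact translateSet_mem_congruentCopies _ (translateSet_mem_congruentCopies _ ⟨_, rfl⟩ _) _

lemma isCompact_diamondCube (n : ℕ) : IsCompact (diamondCube n) := by
  rw [diamondCube_eq]
  exact ((isCompact_unitCube _).image (planeReflection n).continuous).translateSet _

lemma mem_translateSet_diamondCube {n : ℕ} {v x : EuclideanSpace ℝ (Fin (n + 2))} :
    x ∈ translateSet v (diamondCube n) ↔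
      (|(x 0 - v 0) + (x 1 - v 1)| ≤ √2 / 2 ∧ |(x 0 - v 0) - (x 1 - v 1)| ≤ √2 / 2) ∧
        ∀ i : Fin n, x i.succ.succ - v i.succ.succ ∈ Set.Icc (0 : ℝ) 1 := by
  rw [mem_translateSet]
  rfl

lemma mem_interior_translateSet_diamondCube {n : ℕ} {v x : EuclideanSpace ℝ (Fin (n + 2))}
    (h0 : |(x 0 - v 0) + (x 1 - v 1)| < √2 / 2) (h1 : |(x 0 - v 0) - (x 1 - v 1)| < √2 / 2)
    (h2 : ∀ i : Fin n, x i.succ.succ - v i.succ.succ ∈ Set.Ioo (0 : ℝ) 1) :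
    x ∈ interior (translateSet v (diamondCube n)) := by
  refine interior_maximal (t := {x | (|(x 0 - v 0) + (x 1 - v 1)| < √2 / 2 ∧
    |(x 0 - v 0) - (x 1 - v 1)| < √2 / 2) ∧
        ∀ i : Fin n, x i.succ.succ - v i.succ.succ ∈ Set.Ioo (0 : ℝ) 1}) ?_ ?_ ⟨⟨h0, h1⟩, h2⟩
  · rintro y ⟨⟨h0, h1⟩, h2⟩
    exact mem_translateSet_diamondCube.2
      ⟨⟨h0.le, h1.le⟩, fun i => Set.Ioo_subset_Icc_self (h2 i)⟩
  · have e : ∀ i, Continuous fun y : EuclideanSpace ℝ (Fin (n + 2)) => y i - v i := fun i =>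
      (continuous_coord i).sub continuous_const
    refine IsOpen.inter ?_ ?_
    · exact (isOpen_lt ((e 0).add (e 1)).abs continuous_const).inter
        (isOpen_lt ((e 0).sub (e 1)).abs continuous_const)
    · have hI : IsOpen (⋂ i : Fin n, {y : EuclideanSpace ℝ (Fin (n + 2)) |
          y i.succ.succ - v i.succ.succ ∈ Set.Ioo (0 : ℝ) 1}) :=
        isOpen_iInter_of_finite fun i => isOpen_Ioo.preimage (e _)
      rwa [← Set.ofPred_forall] at hI

/-- The interiors of a diamond with centre `(p, q)` and of an axis-parallel unit square with lower
left vertex `(a, b)` intersect. -/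
def PlaneTouch (p q a b : ℝ) : Prop :=
  (a - p < √2 / 2 ∧ p - (a + 1) < √2 / 2 ∧ b - q < √2 / 2 ∧ q - (b + 1) < √2 / 2) ∧
  (a - p + (b - q) < √2 / 2 ∧ a - p + (q - (b + 1)) < √2 / 2 ∧
    p - (a + 1) + (b - q) < √2 / 2 ∧ p - (a + 1) + (q - (b + 1)) < √2 / 2)

/-- The diamond with centre `(p, q)` and the axis-parallel unit square with lower left vertex
`(a, b)` are separated by a horizontal or vertical line, or by a line of slope `-1` above the
diamond. -/
def PlaneApart (p q a b : ℝ) : Prop :=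
  √2 / 2 < a - p ∨ √2 / 2 < q - (b + 1) ∨ √2 / 2 < a - p + (b - q)

lemma exists_mem_of_planeTouch {p q a b : ℝ} (h : PlaneTouch p q a b) :
    ∃ x y : ℝ, a ≤ x ∧ x ≤ a + 1 ∧ b ≤ y ∧ y ≤ b + 1 ∧
      |(x - p) + (y - q)| < √2 / 2 ∧ |(x - p) - (y - q)| < √2 / 2 := by
  obtain ⟨⟨h1, h2, h3, h4⟩, h5, h6, h7, h8⟩ := h
  have hr : 0 < √2 / 2 := by positivity
  -- the point of the square closest to the centre of the diamond
  have clamp : ∀ p a : ℝ, ∃ x, a ≤ x ∧ x ≤ a + 1 ∧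
      (x - p = 0 ∨ x - p = a - p ∧ 0 ≤ a - p ∨ p - x = p - (a + 1) ∧ 0 ≤ p - (a + 1)) := by
    intro p a
    rcases le_total p a with h | h
    · exact ⟨a, le_rfl, by linarith, Or.inr (Or.inl ⟨rfl, by linarith⟩)⟩
    · rcases le_total p (a + 1) with h' | h'
      · exact ⟨p, h, h', Or.inl (sub_self p)⟩
      · exact ⟨a + 1, by linarith, le_rfl, Or.inr (Or.inr ⟨rfl, by linarith⟩)⟩
  obtain ⟨x, hx, hx', hxp⟩ := clamp p a
  obtain ⟨y, hy, hy', hyq⟩ := clamp q b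
  refine ⟨x, y, hx, hx', hy, hy', ?_, ?_⟩ <;> rw [abs_lt] <;>
    rcases hxp with hxp | ⟨hxp, hxp'⟩ | ⟨hxp, hxp'⟩ <;>
    rcases hyq with hyq | ⟨hyq, hyq'⟩ | ⟨hyq, hyq'⟩ <;> constructor <;> linarith

lemma interior_diamondCube_inter {n : ℕ} {p q a b : ℝ} {f f' : Fin n → ℝ}
    (h : PlaneTouch p q a b) (hf : ∀ i, |f i - f' i| < 1) :
    (interior (translateSet (splitPoint p q f) (diamondCube n)) ∩
      translateSet (splitPoint a b f') (unitCube (n + 2))).Nonempty := by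
  obtain ⟨x, y, hx, hx', hy, hy', h1, h2⟩ := exists_mem_of_planeTouch h
  have hf' := fun i => abs_lt.1 (hf i)
  refine ⟨splitPoint x y fun i => (f i + f' i + 1) / 2,
    mem_interior_translateSet_diamondCube h1 h2 fun i => ?_, ?_⟩
  · obtain ⟨h3, h4⟩ := hf' i
    simp only [splitPoint_succ_succ]
    exact ⟨by linarith, by linarith⟩
  · rw [mem_translateSet, unitCube, Set.mem_ofPred_eq, forall_fin_add_two]
    simp only [splitPoint_zero, splitPoint_one, splitPoint_succ_succ, PiLp.sub_apply]
    refine ⟨⟨by linarith, by linarith⟩, ⟨by linarith, by linarith⟩, fun i => ?_⟩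
    obtain ⟨h3, h4⟩ := hf' i
    exact ⟨by linarith, by linarith⟩

lemma disjoint_diamondCube_of_planeApart {n : ℕ} {p q a b : ℝ} {f f' : Fin n → ℝ}
    (h : PlaneApart p q a b) :
    Disjoint (translateSet (splitPoint p q f) (diamondCube n))
      (translateSet (splitPoint a b f') (unitCube (n + 2))) := by
  rw [Set.disjoint_left]
  intro x hx hx'
  rw [mem_translateSet_diamondCube] at hx
  rw [mem_translateSet] at hx'
  obtain ⟨⟨h0, h1⟩, -⟩ := hx
  have c0 := hx' 0
  have c1 := hx' 1
  rw [abs_le] at h0 h1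
  simp only [splitPoint_zero, splitPoint_one, PiLp.sub_apply, Set.mem_Icc] at h0 h1 c0 c1
  obtain ⟨h0, h0'⟩ := h0
  obtain ⟨h1, h1'⟩ := h1
  obtain ⟨c0, c0'⟩ := c0
  obtain ⟨c1, c1'⟩ := c1
  rcases h with h | h | h <;> linarith

lemma disjoint_diamondCube_of_coord {n : ℕ} {p q a b : ℝ} {f f' : Fin n → ℝ} {i : Fin n}
    (h : 1 < |f i - f' i|) :
    Disjoint (translateSet (splitPoint p q f) (diamondCube n))
      (translateSet (splitPoint a b f') (unitCube (n + 2))) := by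
  rw [Set.disjoint_left]
  intro x hx hx'
  rw [mem_translateSet_diamondCube] at hx
  rw [mem_translateSet] at hx'
  obtain ⟨a0, a1⟩ := hx.2 i
  obtain ⟨b0, b1⟩ := hx' i.succ.succ
  simp only [splitPoint_succ_succ, PiLp.sub_apply] at a0 a1 b0 b1
  exact absurd h (not_lt.2 (abs_le.2 ⟨by linarith, by linarith⟩))

lemma interior_diamondCube_inter_diamondCube {n : ℕ} {p q p' q' : ℝ} {f f' : Fin n → ℝ}
    (h : |p - p'| ≤ 1 / 4) (h' : |q - q'| ≤ 1 / 4) (hf : ∀ i, |f i - f' i| < 1) :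
    (interior (translateSet (splitPoint p q f) (diamondCube n)) ∩
      translateSet (splitPoint p' q' f') (diamondCube n)).Nonempty := by
  have hf' := fun i => abs_lt.1 (hf i)
  have hr : (14 / 10 : ℝ) ≤ √2 := Real.le_sqrt_of_sq_le (by norm_num)
  rw [abs_le] at h h'
  refine ⟨splitPoint p' q' fun i => (f i + f' i + 1) / 2,
    mem_interior_translateSet_diamondCube ?_ ?_ fun i => ?_, mem_translateSet_diamondCube.2
      ⟨⟨?_, ?_⟩, fun i => ?_⟩⟩
  · simp only [splitPoint_zero, splitPoint_one]
    rw [abs_lt]; constructor <;> linarith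
  · simp only [splitPoint_zero, splitPoint_one]
    rw [abs_lt]; constructor <;> linarith
  · obtain ⟨h3, h4⟩ := hf' i
    simp only [splitPoint_succ_succ]
    exact ⟨by linarith, by linarith⟩
  · simpa using by linarith
  · simpa using by linarith
  · obtain ⟨h3, h4⟩ := hf' i
    simp only [splitPoint_succ_succ]
    exact ⟨by linarith, by linarith⟩

/-- First coordinates of the centres of five diamonds. -/
noncomputable def diamondX : Fin 5 → ℝ := ![0, 0, 0, -(4 / 100), -(16 / 100)]

/-- Second coordinates of the centres of five diamonds, which move first upwards, then to the
left. -/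
noncomputable def diamondY : Fin 5 → ℝ := ![0, 4 / 100, 8 / 100, 8 / 100, 8 / 100]

/-- First coordinates of the lower left vertices of five disjoint axis-parallel unit squares: two
below the diamonds, one to the right, and two above. The `k`-th diamond touches precisely the
squares number `k, …, 4`. -/
noncomputable def squareX : Fin 5 → ℝ :=
  ![1 / 100, -(101 / 100), √2 / 2 - 2 / 100, 1 / 100, -(101 / 100)]

/-- Second coordinates of the lower left vertices of the five squares. -/
noncomputable def squareY : Fin 5 → ℝ :=
  ![-(√2 / 2) - 97 / 100, -(√2 / 2) - 93 / 100, -(1 / 2), √2 / 2 - 3 / 100, √2 / 2 - 3 / 100]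

lemma planeTouch_diamond_square {k i : Fin 5} (h : k ≤ i) :
    PlaneTouch (diamondX k) (diamondY k) (squareX i) (squareY i) := by
  have h1 : (14 / 10 : ℝ) ≤ √2 := Real.le_sqrt_of_sq_le (by norm_num)
  have h2 : √2 ≤ (15 / 10 : ℝ) := Real.sqrt_le_iff.2 ⟨by norm_num, by norm_num⟩
  revert h
  fin_cases k <;> fin_cases i <;> intro h <;> first
    | exact absurd h (by decide)
    | (simp only [PlaneTouch, diamondX, diamondY, squareX, squareY]
       refine ⟨⟨?_, ?_, ?_, ?_⟩, ?_, ?_, ?_, ?_⟩ <;> simp <;> linarith)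

lemma planeApart_diamond_square {k i : Fin 5} (h : i < k) :
    PlaneApart (diamondX k) (diamondY k) (squareX i) (squareY i) := by
  have h1 : (14 / 10 : ℝ) ≤ √2 := Real.le_sqrt_of_sq_le (by norm_num)
  revert h
  fin_cases k <;> fin_cases i <;> intro h <;> first
    | exact absurd h (by decide)
    | (refine Or.inr (Or.inl ?_)
       simp [diamondY, squareY]
       linarith)
    | (refine Or.inl ?_
       simp [diamondX, squareX]
       linarith)
    | (refine Or.inr (Or.inr ?_)
       simp [diamondX, squareX, diamondY, squareY]
       linarith)

lemma one_lt_abs_square_sub {i j : Fin 5} (h : i ≠ j) :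
    1 < |squareX i - squareX j| ∨ 1 < |squareY i - squareY j| := by
  have h1 : (14 / 10 : ℝ) ≤ √2 := Real.le_sqrt_of_sq_le (by norm_num)
  wlog hij : i < j generalizing i j
  · rw [abs_sub_comm (squareX i), abs_sub_comm (squareY i)]
    exact this h.symm (lt_of_le_of_ne (not_lt.1 hij) h.symm)
  rw [lt_abs, lt_abs]
  revert h hij
  fin_cases i <;> fin_cases j <;> intro h hij <;> first
    | exact absurd hij (by decide)
    | (refine Or.inl (Or.inl ?_)
       simp [squareX]
       linarith)
    | (refine Or.inl (Or.inr ?_)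
       simp [squareX]
       linarith)
    | (refine Or.inr (Or.inr ?_)
       simp [squareY]
       linarith)

lemma exists_isTouchingChain_congruentCopies_unitCube (n : ℕ) :
    ∃ c g : Fin (5 * 2 ^ n) → Set (EuclideanSpace ℝ (Fin (n + 2))),
      IsTouchingChain (congruentCopies (unitCube (n + 2))) c g := by
  obtain ⟨ε, hε, hB⟩ := exists_pos_mul_le_half (5 * 2 ^ n)
  -- the leading digit of a number, to base `2 ^ n`, selects the position in the plane
  let top : Fin (5 * 2 ^ n) → Fin 5 := fun k =>
    ⟨k.1 / 2 ^ n, Nat.div_lt_of_lt_mul (by have := k.2; linarith)⟩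
  have htop : ∀ i j, top i = top j → i.1 / 2 ^ n = j.1 / 2 ^ n := fun i j h =>
    congrArg Fin.val h
  have hmono : ∀ i j, i ≤ j → top i ≤ top j := fun i j h => Nat.div_le_div_right h
  have hdX : ∀ k k', |diamondX k - diamondX k'| ≤ 1 / 4 := by
    have : ∀ k, -(1 / 4) ≤ diamondX k ∧ diamondX k ≤ 0 := fun k => by
      fin_cases k <;> simp [diamondX] <;> norm_num
    intro k k'
    have h1 := this k
    have h2 := this k'
    rw [abs_le]; constructor <;> linarith
  have hdY : ∀ k k', |diamondY k - diamondY k'| ≤ 1 / 4 := by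
    have : ∀ k, 0 ≤ diamondY k ∧ diamondY k ≤ 1 / 4 := fun k => by
      fin_cases k <;> simp [diamondY] <;> norm_num
    intro k k'
    have h1 := this k
    have h2 := this k'
    rw [abs_le]; constructor <;> linarith
  refine ⟨fun k => translateSet (splitPoint (diamondX (top k)) (diamondY (top k))
      fun i => hubCoord ε k i) (diamondCube n),
    fun N => translateSet (splitPoint (squareX (top N)) (squareY (top N))
      fun i => leafCoord ε N i) (unitCube (n + 2)), ?_⟩
  exact
  { mem_c := fun k => translateSet_diamondCube_mem _
    mem_g := fun k => translateSet_unitCube_mem _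
    isCompact_c := fun k => (isCompact_diamondCube n).translateSet _
    isCompact_g := fun k => (isCompact_unitCube _).translateSet _
    disjoint_g := fun i j hij => by
      by_cases ht : top i = top j
      · obtain ⟨l, hl, h⟩ := one_lt_abs_leafCoord_sub hε hB i.2 j.2 (Fin.val_ne_of_ne hij)
          (htop i j ht)
        exact disjoint_translateSet_unitCube (i := (⟨l, hl⟩ : Fin n).succ.succ) h
      · rcases one_lt_abs_square_sub ht with h | h
        · exact disjoint_translateSet_unitCube (i := 0) h
        · exact disjoint_translateSet_unitCube (i := 1) h
    disjoint_c_g := fun i k hik => by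
      rcases (hmono i k hik.le).eq_or_lt with ht | ht
      · obtain ⟨l, hl, h⟩ := one_lt_abs_hubCoord_sub_leafCoord hε hik (htop i k ht)
        exact disjoint_diamondCube_of_coord (i := ⟨l, hl⟩) h
      · exact disjoint_diamondCube_of_planeApart (planeApart_diamond_square ht)
    inter_c_g := fun k i hki => interior_diamondCube_inter
      (planeTouch_diamond_square (hmono k i hki)) fun l =>
      abs_hubCoord_sub_leafCoord_lt hε hB i.2 hki l
    inter_c_c := fun k k' _ => interior_diamondCube_inter_diamondCube (hdX _ _) (hdY _ _) fun l =>
      abs_hubCoord_sub_hubCoord_lt hε hB k.2 k'.2 l }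

theorem five_mul_two_pow_le_competitiveRatio_congruentCopies {n : ℕ}
    {K : Set (EuclideanSpace ℝ (Fin (n + 2)))} (hK : IsHypercube K)
    (A : RandomizedOnlineAlgorithm.{u} (congruentCopies K)) :
    (5 * 2 ^ n : ℕ) ≤ A.competitiveRatio := by
  obtain ⟨c, g, h⟩ := exists_isTouchingChain_congruentCopies_unitCube n
  exact A.natCast_le_competitiveRatio fun m s =>
    isIntersectionGraph_congruentCopies_of_isHypercube hK
      (h.isIntersectionGraph_phaseGraph translateSet_mem_congruentCopies m s)

/-! ### Fat objects -/

/-- The closed balls in `ℝ^d` with radius in `[1, M]`. -/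
def ballsWithRadius (d : ℕ) (M : ℝ) : Set (Set (EuclideanSpace ℝ (Fin d))) :=
  {K | ∃ x r, 1 ≤ r ∧ r ≤ M ∧ K = Metric.closedBall x r}

lemma minBoundaryDist_le {d : ℕ} {K : Set (EuclideanSpace ℝ (Fin d))}
    {x y : EuclideanSpace ℝ (Fin d)} (hy : y ∈ frontier K) : minBoundaryDist K x ≤ dist x y :=
  Metric.infDist_le_dist_of_mem hy

lemma le_maxBoundaryDist {d : ℕ} {K : Set (EuclideanSpace ℝ (Fin d))} (hK : IsCompact K)
    {x y : EuclideanSpace ℝ (Fin d)} (hy : y ∈ frontier K) : dist x y ≤ maxBoundaryDist K x := by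
  have hc : IsCompact (frontier K) := hK.of_isClosed_subset isClosed_frontier
    hK.isClosed.frontier_subset
  have hb : BddAbove ((fun y => dist x y) '' frontier K) :=
    (hc.image (continuous_const.dist continuous_id)).bddAbove
  exact le_csSup hb ⟨y, hy, rfl⟩

lemma frontier_nonempty_closedBall {n : ℕ} (x : EuclideanSpace ℝ (Fin (n + 1))) {r : ℝ}
    (hr : 0 ≤ r) : (frontier (Metric.closedBall x r)).Nonempty := by
  rw [frontier_closedBall']
  exact NormedSpace.sphere_nonempty.2 hr

lemma minBoundaryDist_closedBall_center {n : ℕ} (x : EuclideanSpace ℝ (Fin (n + 1))) {r : ℝ}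
    (hr : 0 ≤ r) : minBoundaryDist (Metric.closedBall x r) x = r := by
  refine le_antisymm ?_ ?_
  · obtain ⟨y, hy⟩ := frontier_nonempty_closedBall x hr
    refine (minBoundaryDist_le hy).trans_eq ?_
    rw [frontier_closedBall', Metric.mem_sphere, dist_comm] at hy
    exact hy
  · refine (Metric.le_infDist (frontier_nonempty_closedBall x hr)).2 fun y hy => ?_
    rw [frontier_closedBall', Metric.mem_sphere, dist_comm] at hy
    exact hy.ge

lemma maxBoundaryDist_closedBall_center {n : ℕ} (x : EuclideanSpace ℝ (Fin (n + 1))) {r : ℝ}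
    (hr : 0 ≤ r) : maxBoundaryDist (Metric.closedBall x r) x = r := by
  have h : (fun y => dist x y) '' frontier (Metric.closedBall x r) = {r} := by
    obtain ⟨z, hz⟩ := frontier_nonempty_closedBall x hr
    refine Set.eq_singleton_iff_nonempty_unique_mem.2 ⟨⟨_, z, hz, rfl⟩, ?_⟩
    rintro _ ⟨y, hy, rfl⟩
    rw [frontier_closedBall', Metric.mem_sphere, dist_comm] at hy
    exact hy
  rw [maxBoundaryDist, h, csSup_singleton]

/-- Balls are `α`-fat for all `α ≤ 1`. Their only aspect point is the centre, since every other
point has boundary points at different distances on its diameter. -/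
lemma ballsWithRadius_subset_fatObjects (n : ℕ) {α M : ℝ} (hα : α ≤ 1) :
    ballsWithRadius (n + 1) M ⊆ fatObjects (n + 1) α M := by
  rintro _ ⟨c, r, hr, hrM, rfl⟩
  have hr0 : 0 < r := by linarith
  have hK := isCompact_closedBall c r
  have hcK : c ∈ Metric.closedBall c r := Metric.mem_closedBall_self hr0.le
  have hcr : minBoundaryDist (Metric.closedBall c r) c / maxBoundaryDist (Metric.closedBall c r) c
      = 1 := by
    rw [minBoundaryDist_closedBall_center c hr0.le, maxBoundaryDist_closedBall_center c hr0.le,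
      div_self hr0.ne']
  refine ⟨⟨hK, ?_, c, ⟨hcK, fun y _ => ?_⟩, ?_⟩, fun x hx => ?_⟩
  · rw [interior_closedBall c hr0.ne']
    exact Metric.nonempty_ball.2 hr0
  · rw [hcr]
    obtain ⟨z, hz⟩ := frontier_nonempty_closedBall c hr0.le
    have h1 := minBoundaryDist_le (x := y) hz
    have h2 := le_maxBoundaryDist hK (x := y) hz
    exact div_le_one_of_le₀ (h1.trans h2) (dist_nonneg.trans h2)
  · rw [hcr]; exact hα
  · suffices x = c by
      rw [this, minBoundaryDist_closedBall_center c hr0.le]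
      exact ⟨hr, hrM⟩
    have h1 := hx.2 c hcK
    rw [hcr] at h1
    have hle : maxBoundaryDist (Metric.closedBall c r) x ≤
        minBoundaryDist (Metric.closedBall c r) x := by
      obtain ⟨z, hz⟩ := frontier_nonempty_closedBall c hr0.le
      have h2 := le_maxBoundaryDist hK (x := x) hz
      rcases (dist_nonneg.trans h2).eq_or_lt with h0 | h0
      · rw [← h0]; exact Metric.infDist_nonneg
      · exact (one_le_div h0).1 h1
    by_contra hne
    have hs : 0 < ‖x - c‖ := norm_pos_iff.2 (sub_ne_zero.2 hne)
    -- the boundary points `c ± t • (x - c)` with `t = r / ‖x - c‖`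
    set t := r / ‖x - c‖ with ht
    have ht0 : 0 < t := div_pos hr0 hs
    have hts : t * ‖x - c‖ = r := div_mul_cancel₀ _ hs.ne'
    have hfr : ∀ s : ℝ, |s| = t → c + s • (x - c) ∈ frontier (Metric.closedBall c r) := by
      intro s hs'
      rw [frontier_closedBall', mem_sphere_iff_norm, add_sub_cancel_left, norm_smul,
        Real.norm_eq_abs, hs', hts]
    have hd : ∀ s : ℝ, dist x (c + s • (x - c)) = |1 - s| * ‖x - c‖ := by
      intro s
      rw [dist_eq_norm, ← Real.norm_eq_abs, ← norm_smul, sub_smul, one_smul]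
      congr 1
      abel
    have h3 := minBoundaryDist_le (x := x) (hfr t (abs_of_pos ht0))
    have h4 := le_maxBoundaryDist hK (x := x) (hfr (-t) (by rw [abs_neg, abs_of_pos ht0]))
    rw [hd] at h3 h4
    have h5 : |1 - -t| ≤ |1 - t| := le_of_mul_le_mul_right (h4.trans (hle.trans h3)) hs
    rw [abs_of_pos (by linarith)] at h5
    rcases abs_cases (1 - t) with h | h <;> linarith

lemma translateSet_mem_ballsWithRadius {d : ℕ} {M : ℝ} :
    ∀ S ∈ ballsWithRadius d M, ∀ v, translateSet v S ∈ ballsWithRadius d M := by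
  rintro _ ⟨x, r, h1, h2, rfl⟩ v
  exact ⟨v + x, r, h1, h2, translateSet_closedBall v x r⟩

/-! ### A large ball that moves past many small ones -/

lemma exists_digit_ne {a b N : ℕ} (hab : a ≠ b) (r : ℕ) (h : a / N ^ r = b / N ^ r) :
    ∃ i < r, a / N ^ i % N ≠ b / N ^ i % N := by
  induction r with
  | zero => simp at h; omega
  | succ r ih =>
    by_cases hr : a / N ^ r = b / N ^ r
    · obtain ⟨i, hi, hi'⟩ := ih hr
      exact ⟨i, by omega, hi'⟩
    · rw [pow_succ, ← Nat.div_div_eq_div_mul, ← Nat.div_div_eq_div_mul] at h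
      refine ⟨r, by omega, fun hm => hr ?_⟩
      rw [← Nat.div_add_mod (a / N ^ r) N, ← Nat.div_add_mod (b / N ^ r) N, h, hm]

/-- The point of `ℝ^(n+1)` with the given first coordinate and remaining coordinates. -/
noncomputable def axisPoint {n : ℕ} (a : ℝ) (f : Fin n → ℝ) :
    EuclideanSpace ℝ (Fin (n + 1)) := WithLp.toLp 2 (Fin.cons a f)

lemma dist_axisPoint_sq {n : ℕ} (a b : ℝ) (f g : Fin n → ℝ) :
    dist (axisPoint a f) (axisPoint b g) ^ 2 = (a - b) ^ 2 + ∑ i, (f i - g i) ^ 2 := by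
  rw [EuclideanSpace.dist_eq, Real.sq_sqrt (Finset.sum_nonneg fun _ _ => sq_nonneg _),
    Fin.sum_univ_succ]
  simp [axisPoint, Real.dist_eq, sq_abs]

/-- The coordinates of the centre of the `a`-th small ball orthogonal to the first axis: three
times the last `n` digits of `a` to base `N`. -/
def orthCoord (N n a : ℕ) (i : Fin n) : ℝ := 3 * ((a / N ^ (i : ℕ) % N : ℕ) : ℝ)

/-- The time at which a large ball, moving along the first axis, leaves the `a`-th small ball. It
is close to three times the leading digit of `a` to base `N` and increases with `a`. -/
noncomputable def exitTime (N n a : ℕ) : ℝ :=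
  3 * ((a / N ^ n : ℕ) : ℝ) + (a + 1) / (N ^ (n + 1) + 1)


lemma exitTime_add_le {N n a b : ℕ} (hab : a < b) :
    exitTime N n a + 1 / (N ^ (n + 1) + 1) ≤ exitTime N n b := by
  have h1 : ((a / N ^ n : ℕ) : ℝ) ≤ (b / N ^ n : ℕ) := by
    exact_mod_cast Nat.div_le_div_right hab.le
  have h2 : ((a : ℝ) + 1 + 1) / (N ^ (n + 1) + 1) ≤ (b + 1) / (N ^ (n + 1) + 1) := by
    have : (a : ℝ) + 1 ≤ b := by exact_mod_cast hab
    gcongr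
  rw [add_div] at h2
  rw [exitTime, exitTime]
  linarith

lemma inv_le_exitTime (N n a : ℕ) : 1 / (N ^ (n + 1) + 1) ≤ exitTime N n a := by
  have h1 : (1 : ℝ) / (N ^ (n + 1) + 1) ≤ (a + 1) / (N ^ (n + 1) + 1) := by
    have : (0 : ℝ) ≤ a := Nat.cast_nonneg a
    gcongr
    linarith
  have h2 : (0 : ℝ) ≤ (a / N ^ n : ℕ) := Nat.cast_nonneg _
  rw [exitTime]
  linarith

lemma div_lt_one_of_lt_pow {N n a : ℕ} (ha : a < N ^ (n + 1)) :
    ((a : ℝ) + 1) / (N ^ (n + 1) + 1) < 1 := by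
  rw [div_lt_one (by positivity)]
  have : (a : ℝ) < N ^ (n + 1) := by exact_mod_cast ha
  linarith

lemma exitTime_lt {N n a : ℕ} (ha : a < N ^ (n + 1)) : exitTime N n a < 3 * ((N : ℝ) - 1) + 1 := by
  have h1 : a / N ^ n + 1 ≤ N := Nat.div_lt_of_lt_mul (by rwa [← pow_succ])
  have h2 : ((a / N ^ n : ℕ) : ℝ) + 1 ≤ N := by exact_mod_cast h1
  have h3 := div_lt_one_of_lt_pow ha
  rw [exitTime]
  linarith

lemma three_le_abs_sub_of_ne {a b : ℕ} (h : a ≠ b) : 3 ≤ |3 * (a : ℝ) - 3 * (b : ℝ)| := by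
  have h1 : (1 : ℤ) ≤ |(a : ℤ) - b| := Int.one_le_abs (sub_ne_zero.2 (by exact_mod_cast h))
  have h2 : (1 : ℝ) ≤ |(a : ℝ) - b| := by exact_mod_cast h1
  rw [← mul_sub, abs_mul, abs_of_pos (by norm_num)]
  linarith

lemma two_lt_abs_exitTime_sub {N n a b : ℕ} (ha : a < N ^ (n + 1)) (hb : b < N ^ (n + 1))
    (h : a / N ^ n ≠ b / N ^ n) : 2 < |exitTime N n a - exitTime N n b| := by
  have h1 := three_le_abs_sub_of_ne h
  have h2 := div_lt_one_of_lt_pow ha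
  have h3 := div_lt_one_of_lt_pow hb
  have h4 : (0 : ℝ) < (a + 1) / (N ^ (n + 1) + 1) := by positivity
  have h5 : (0 : ℝ) < (b + 1) / (N ^ (n + 1) + 1) := by positivity
  rw [exitTime, exitTime]
  rcases le_abs.1 h1 with h | h
  · exact lt_abs.2 (Or.inl (by linarith))
  · exact lt_abs.2 (Or.inr (by linarith))

/-- A ball of radius `M` can be moved past `N ^ (n + 1)` disjoint unit balls in `ℝ^(n+1)`,
leaving one after the other, such that all its positions intersect. -/
lemma exists_isTouchingChain_ballsWithRadius {n N : ℕ} {M : ℝ} (hN : 1 ≤ N) (hM : 1 ≤ M)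
    (hNM : 6 * (n + 1) * ((N : ℝ) - 1) ≤ M) :
    ∃ c g : Fin (N ^ (n + 1)) → Set (EuclideanSpace ℝ (Fin (n + 1))),
      IsTouchingChain (ballsWithRadius (n + 1) M) c g := by
  have hN1 : (0 : ℝ) ≤ (N : ℝ) - 1 := by
    have : (1 : ℝ) ≤ N := by exact_mod_cast hN
    linarith
  have hn0 : (0 : ℝ) ≤ n := Nat.cast_nonneg n
  have hNM' : 6 * ((N : ℝ) - 1) ≤ M := by
    have := mul_nonneg hn0 hN1
    linarith
  set η : ℝ := 1 / (N ^ (n + 1) + 1) with hη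
  have hη0 : 0 < η := by positivity
  let f : ℕ → Fin n → ℝ := fun a => orthCoord N n a
  -- half of the length of the chord along which the large ball overlaps the `a`-th small ball
  let s : ℕ → ℝ := fun a => √((M + 1) ^ 2 - ∑ i, f a i ^ 2)
  let τ : ℕ → ℝ := exitTime N n
  have hf : ∀ a, ∑ i, f a i ^ 2 ≤ M ^ 2 / 4 := by
    intro a
    have h1 : ∀ i, f a i ^ 2 ≤ (3 * ((N : ℝ) - 1)) ^ 2 := by
      intro i
      have h2 : a / N ^ (i : ℕ) % N + 1 ≤ N := Nat.mod_lt _ hN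
      have h3 : ((a / N ^ (i : ℕ) % N : ℕ) : ℝ) + 1 ≤ N := by exact_mod_cast h2
      simp only [f, orthCoord]
      gcongr
      linarith
    calc ∑ i, f a i ^ 2 ≤ ∑ _i : Fin n, (3 * ((N : ℝ) - 1)) ^ 2 :=
          Finset.sum_le_sum fun i _ => h1 i
      _ = n * (3 * ((N : ℝ) - 1)) ^ 2 := by simp
      _ ≤ (n + 1) ^ 2 * (3 * ((N : ℝ) - 1)) ^ 2 := by
          gcongr
          nlinarith
      _ = (6 * (n + 1) * ((N : ℝ) - 1)) ^ 2 / 4 := by ring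
      _ ≤ M ^ 2 / 4 := by gcongr
  have hs2 : ∀ a, s a ^ 2 = (M + 1) ^ 2 - ∑ i, f a i ^ 2 := fun a =>
    Real.sq_sqrt (by nlinarith [hf a])
  have hs : ∀ a, (M + 1) / 2 ≤ s a := fun a => Real.le_sqrt_of_sq_le (by nlinarith [hf a])
  have hτ : ∀ a < N ^ (n + 1), τ a < M + 1 := fun a ha => by
    have := exitTime_lt ha
    simp only [τ]
    linarith
  have hτη : ∀ a, η ≤ τ a := fun a => inv_le_exitTime N n a
  let p : Fin (N ^ (n + 1)) → EuclideanSpace ℝ (Fin (n + 1)) := fun k =>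
    axisPoint (τ k - η / 2) 0
  let q : Fin (N ^ (n + 1)) → EuclideanSpace ℝ (Fin (n + 1)) := fun a =>
    axisPoint (τ a - s a) (f a)
  have hpq : ∀ k a, dist (p k) (q a) ^ 2 - (M + 1) ^ 2 =
      (τ k - η / 2 - τ a) * (τ k - η / 2 - τ a + 2 * s a) := by
    intro k a
    simp only [p, q, dist_axisPoint_sq, Pi.zero_apply, zero_sub, neg_sq]
    linear_combination hs2 a
  refine ⟨fun k => Metric.closedBall (p k) M, fun a => Metric.closedBall (q a) 1,
    isTouchingChain_of_dist (r := M) (R := M) (r' := 1) (R' := 1) (by linarith) zero_le_one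
      (fun k => ⟨_, _, hM, le_rfl, rfl⟩) (fun k => ⟨_, _, le_rfl, hM, rfl⟩)
      (fun k => isCompact_closedBall _ _) (fun k => isCompact_closedBall _ _)
      (fun k => Metric.ball_subset_closedBall) (fun k => le_rfl) (fun k => le_rfl)
      (fun k => le_rfl) (fun a b hab => ?_) (fun a k hak => ?_) (fun k a hka => ?_)
      (fun k k' => ?_)⟩
  · refine lt_of_pow_lt_pow_left₀ 2 dist_nonneg ?_
    simp only [q, dist_axisPoint_sq]
    by_cases hfab : f a = f b
    · have htop : a.1 / N ^ n ≠ b.1 / N ^ n := fun ht => by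
        obtain ⟨i, hi, hi'⟩ := exists_digit_ne (Fin.val_ne_of_ne hab) n ht
        have h1 : f a ⟨i, hi⟩ = f b ⟨i, hi⟩ := congrFun hfab _
        simp only [f, orthCoord] at h1
        have h2 := mul_left_cancel₀ (by norm_num : (3 : ℝ) ≠ 0) h1
        exact hi' (by exact_mod_cast h2)
      have hsab : s a = s b := by simp only [s, hfab]
      have h1 := two_lt_abs_exitTime_sub a.2 b.2 htop
      rw [hsab, hfab]
      simp only [sub_self, ne_eq, OfNat.ofNat_ne_zero, not_false_eq_true, zero_pow,
        Finset.sum_const_zero, add_zero, sub_sub_sub_cancel_right]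
      rw [← sq_abs (τ a - τ b)]
      have : (1 + 1 : ℝ) < |τ a - τ b| := by simpa only [one_add_one_eq_two] using h1
      gcongr
    · obtain ⟨i, hi⟩ := Function.ne_iff.1 hfab
      have h1 : a.1 / N ^ (i : ℕ) % N ≠ b.1 / N ^ (i : ℕ) % N := fun h => hi (by
        simp only [f, orthCoord, h])
      have h2 : 3 ≤ |f a i - f b i| := three_le_abs_sub_of_ne h1
      have h3 : (f a i - f b i) ^ 2 ≤ ∑ i, (f a i - f b i) ^ 2 :=
        Finset.single_le_sum (f := fun i => (f a i - f b i) ^ 2) (fun _ _ => sq_nonneg _)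
          (Finset.mem_univ i)
      rw [← sq_abs] at h3
      nlinarith [sq_nonneg (τ a - s a - (τ b - s b))]
  · refine lt_of_pow_lt_pow_left₀ 2 dist_nonneg ?_
    have h1 := exitTime_add_le (N := N) (n := n) hak
    have h2 : 0 < τ k - η / 2 - τ a := by
      simp only [τ]
      linarith
    have h3 := mul_pos h2 (show 0 < τ k - η / 2 - τ a + 2 * s a by linarith [hs a])
    linarith [hpq k a]
  · refine lt_of_pow_lt_pow_left₀ 2 (by linarith) ?_
    have h1 : τ k ≤ τ a := by
      rcases hka.eq_or_lt with rfl | h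
      · exact le_rfl
      · have := exitTime_add_le (N := N) (n := n) h
        simp only [τ]
        linarith
    have h2 : τ k - η / 2 - τ a < 0 := by linarith
    have h3 : 0 < τ k - η / 2 - τ a + 2 * s a := by linarith [hs a, hτ a a.2, hτη k]
    have h4 := mul_neg_of_neg_of_pos h2 h3
    rw [add_comm 1 M]
    linarith [hpq k a]
  · refine lt_of_pow_lt_pow_left₀ 2 (by linarith) ?_
    simp only [p, dist_axisPoint_sq]
    simp only [sub_self, ne_eq, OfNat.ofNat_ne_zero, not_false_eq_true, zero_pow,
      Finset.sum_const_zero, add_zero, sub_sub_sub_cancel_right]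
    have h1 : |τ k - τ k'| < M + M := by
      rw [abs_lt]
      constructor <;> linarith [hτ k k.2, hτ k' k'.2, hτη k, hτη k']
    rw [← sq_abs]
    gcongr

theorem exists_mul_pow_le_competitiveRatio_fatObjects {d : ℕ} (hd : 1 ≤ d) :
    ∃ c : ℝ, 0 < c ∧ ∀ α M : ℝ, 0 < α → α ≤ 1 → 1 ≤ M →
      ∀ A : RandomizedOnlineAlgorithm.{u} (fatObjects d α M),
        ENNReal.ofReal (c * (α * M ^ d)) ≤ A.competitiveRatio := by
  obtain ⟨n, rfl⟩ := Nat.exists_eq_add_of_le' hd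
  have hC : (0 : ℝ) < 6 * (n + 1) := by positivity
  refine ⟨1 / (6 * (n + 1)) ^ (n + 1), by positivity, fun α M hα hα1 hM A => ?_⟩
  set N := ⌈M / (6 * (n + 1))⌉₊ with hN
  have hM0 : 0 < M := by linarith
  have hNle : M / (6 * (n + 1)) ≤ N := Nat.le_ceil _
  have hN1 : 1 ≤ N := Nat.one_le_ceil_iff.2 (by positivity)
  have hNlt : (N : ℝ) < M / (6 * (n + 1)) + 1 := Nat.ceil_lt_add_one (by positivity)
  obtain ⟨c, g, h⟩ := exists_isTouchingChain_ballsWithRadius (n := n) hN1 hM (by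
    have h1 : (N : ℝ) - 1 ≤ M / (6 * (n + 1)) := by linarith
    rwa [le_div_iff₀ hC, mul_comm] at h1)
  have hA : ((N ^ (n + 1) : ℕ) : ℝ≥0∞) ≤ A.competitiveRatio :=
    A.natCast_le_competitiveRatio fun m s =>
      (h.isIntersectionGraph_phaseGraph translateSet_mem_ballsWithRadius m s).mono
        (ballsWithRadius_subset_fatObjects n hα1)
  refine le_trans ?_ hA
  rw [← ENNReal.ofReal_natCast]
  refine ENNReal.ofReal_le_ofReal ?_
  calc 1 / (6 * ((n : ℝ) + 1)) ^ (n + 1) * (α * M ^ (n + 1))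
      ≤ 1 / (6 * ((n : ℝ) + 1)) ^ (n + 1) * (1 * M ^ (n + 1)) := by gcongr
    _ = (M / (6 * (n + 1))) ^ (n + 1) := by rw [div_pow]; ring
    _ ≤ (N : ℝ) ^ (n + 1) := by gcongr
    _ = ((N ^ (n + 1) : ℕ) : ℝ) := by push_cast; rfl

theorem mainTheorem7 :
    (∀ A : RandomizedOnlineAlgorithm.{u} (unitBalls 3), 13 / 2 ≤ A.competitiveRatio) ∧
    (∀ (d : ℕ) (K : Set (EuclideanSpace ℝ (Fin d))), 1 ≤ d → IsHypercube K →
      ∀ A : RandomizedOnlineAlgorithm.{u} (translates K),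
        2 ^ (d - 1) + 1 / 2 ≤ A.competitiveRatio) ∧
    (∀ (k : ℕ) (K : Set (EuclideanSpace ℝ (Fin 2))), 3 ≤ k → k ≠ 4 → IsRegularPolygon k K →
      ∀ A : RandomizedOnlineAlgorithm.{u} (translates K), 3 ≤ A.competitiveRatio) ∧
    (∀ (d : ℕ) (K : Set (EuclideanSpace ℝ (Fin d))), 2 ≤ d → IsHypercube K →
      ∀ A : RandomizedOnlineAlgorithm.{u} (congruentCopies K),
        2 ^ d + 1 / 2 ≤ A.competitiveRatio) ∧
    (∀ d : ℕ, 1 ≤ d → ∃ c : ℝ, 0 < c ∧ ∀ α M : ℝ, 0 < α → α ≤ 1 → 1 ≤ M →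
      ∀ A : RandomizedOnlineAlgorithm.{u} (fatObjects d α M),
        ENNReal.ofReal (c * (α * M ^ d)) ≤ A.competitiveRatio) := by
  have half_le : (1 : ℝ≥0∞) / 2 ≤ 1 := ENNReal.div_le_of_le_mul (by norm_num)
  refine ⟨fun A => ?_, fun d K hd hK A => ?_, fun k K hk _ hK A => ?_, fun d K hd hK A => ?_,
    fun d hd => exists_mul_pow_le_competitiveRatio_fatObjects hd⟩
  · refine le_trans ?_ (seven_le_competitiveRatio_unitBalls A)
    exact ENNReal.div_le_of_le_mul (by norm_num)
  · refine le_trans ?_ (two_pow_le_competitiveRatio_translates hd hK A)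
    obtain ⟨n, rfl⟩ := Nat.exists_eq_add_of_le' hd
    calc (2 : ℝ≥0∞) ^ (n + 1 - 1) + 1 / 2 ≤ 2 ^ n + 2 ^ n := by
          rw [Nat.add_sub_cancel]
          gcongr
          exact half_le.trans (one_le_pow₀ (by norm_num))
      _ = ((2 ^ (n + 1) : ℕ) : ℝ≥0∞) := by push_cast; ring
  · exact_mod_cast three_le_competitiveRatio_isRegularPolygon hk hK A
  · obtain ⟨n, rfl⟩ := Nat.exists_eq_add_of_le' hd
    refine le_trans ?_ (five_mul_two_pow_le_competitiveRatio_congruentCopies hK A)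
    calc (2 : ℝ≥0∞) ^ (n + 2) + 1 / 2 ≤ 2 ^ (n + 2) + 2 ^ n := by
          gcongr
          exact half_le.trans (one_le_pow₀ (by norm_num))
      _ = ((5 * 2 ^ n : ℕ) : ℝ≥0∞) := by push_cast; ring
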